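/- Let $r\ge 1$. For each real $N>0$ let $A_{n,N}$ ($n\ge 1$) be nonsingular and $B_{n,N}$ ($n\ge 0$) be Hermitian complex $r\times r$ matrices, and let $P_{n,N}$ be the matrix polynomials defined by $P_{-1,N}=0$, $P_{0,N}=I_r$ and $$xP_{n,N}(x)=A_{n+1,N}P_{n+1,N}(x)+B_{n,N}P_{n,N}(x)+A_{n,N}^*P_{n-1,N}(x),\qquad n\ge 0 .$$ Write $\lim_{n/N\to s}$ for the limit as $n,N\to\infty$ with $n/N\to s$. Let $A_s,B_s$ ($s\ge 0$) be complex $r\times r$ matrices depending continuously on $s\ge 0$ such that, for every $s>0$, $\lim_{n/N\to s}A_{n,N}=A_s$, $\lim_{n/N\to s}B_{n,N}=B_s$ and $A_s$ is nonsingular. Fix $s>0$, and let $M>0$ be such that all zeros of $\det P_{n,N}$ lie in $[-M,M]$ whenever $n,N$ are large enough and $n/N$ is close enough to $s$. Put $f_s(z,x)=\det(zA_s^*+B_s+z^{-1}A_s-xI_r)$ and let $z_1(x,s),\dots,z_{2r}(x,s)$ be the roots $z$ of $f_s(z,x)=0$, repeated according to multiplicity and ordered so that $|z_1(x,s)|\le\dots\le|z_{2r}(x,s)|$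 (ties broken arbitrarily). Let $S_s$ be the set of those $x\in\mathbb C$ for which one cannot choose unit vectors $\mathbf v_k(x,s)\in\mathbb C^r$, $k=1,\dots,2r$, in the null spaces of $z_kA_s^*+B_s+z_k^{-1}A_s-xI_r$ (where $z_k=z_k(x,s)$) such that, for each $k$, the span of the vectors $\mathbf v_l(x,s)$ with $z_l(x,s)=z_k(x,s)$ has dimension equal both to the dimension of that null space and to the multiplicity of $z_k(x,s)$ as a zero of $Z^rf_s(Z,x)$. For $x\notin S_s$ let $\mathbf v_k(x,s)$ denote any such choice. Then: 1. $S_s$ is finite. 2. For all $x\in\mathbb C\setminus([-M,M]\cup S_s)$ the limit $R_s(x)=\lim_{n/N\to s}P_{n,N}(x)P_{n+1,N}(x)^{-1}$ exists entrywise and is diagonalizable; the vectors $\mathbf v_1(x,s),\dots,\mathbf v_r(x,s)$ are linearly independent and $$R_s(x)\,\mathbf v_k(x,s)=z_k(x,s)\,\mathbf v_k(x,s),\qquad k=1,\dots,r.$$ The convergence is uniform on compact subsets of $\mathbb C\setminus([-M,M]\cup S_s)$. 3. We have $$\lim_{n/N\to s}\frac{\det P_{n,N}(x)}{\det P_{n+1,N}(x)}=z_1(x,s)\cdots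 z_r(x,s),$$ uniformly on compact subsets of $\mathbb C\setminus[-M,M]$. -/

import Mathlib

open Filter Topology
open scoped Matrix

noncomputable section

namespace RatioAsymptotics

variable {r : ℕ}

/-! ### The matrix orthogonal polynomials -/

/-- The matrix-valued polynomials generated by
`x P_n(x) = A_{n+1} P_{n+1}(x) + B_n P_n(x) + A_n^* P_{n-1}(x)`, `n ≥ 0`,
with `P_{-1} = 0` and `P_0 = I`, as functions of `x`, for the coefficient sequences `A` and `B`
(every `A_n` with `n ≥ 1` being nonsingular; `A_0` plays no role). -/
def orthPoly (A B : ℕ → Matrix (Fin r) (Fin r) ℂ) : ℕ → ℂ → Matrix (Fin r) (Fin r) ℂ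
  | 0, _ => 1
  | 1, x => (A 1)⁻¹ * (x • (1 : Matrix (Fin r) (Fin r) ℂ) - B 0)
  | n + 2, x => (A (n + 2))⁻¹ *
      (x • orthPoly A B (n + 1) x - B (n + 1) * orthPoly A B (n + 1) x
        - (A (n + 1))ᴴ * orthPoly A B n x)

/-- The recurrence relation for `n = 0`, where `P_{-1} = 0`. -/
theorem orthPoly_recurrence_zero (A B : ℕ → Matrix (Fin r) (Fin r) ℂ)
    (hA : ∀ n, 1 ≤ n → (A n).det ≠ 0) (x : ℂ) :
    x • orthPoly A B 0 x = A 1 * orthPoly A B 1 x + B 0 * orthPoly A B 0 x := by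
  have h : IsUnit (A 1).det := isUnit_iff_ne_zero.mpr (hA 1 le_rfl)
  simp only [orthPoly]
  rw [Matrix.mul_nonsing_inv_cancel_left _ _ h]
  simp

/-- The recurrence relation for `n ≥ 1`. -/
theorem orthPoly_recurrence_succ (A B : ℕ → Matrix (Fin r) (Fin r) ℂ)
    (hA : ∀ n, 1 ≤ n → (A n).det ≠ 0) (n : ℕ) (x : ℂ) :
    x • orthPoly A B (n + 1) x =
      A (n + 2) * orthPoly A B (n + 2) x + B (n + 1) * orthPoly A B (n + 1) x
        + (A (n + 1))ᴴ * orthPoly A B n x := by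
  have h : IsUnit (A (n + 2)).det := isUnit_iff_ne_zero.mpr (hA _ (by omega))
  conv_rhs => rw [orthPoly]
  rw [Matrix.mul_nonsing_inv_cancel_left _ _ h]
  abel

/-! ### The local limit `n / N → s` -/

/-- The filter of the local limit `lim_{n/N → s}`: both `n` and `N` tend to infinity in such a way
that `n / N` converges to `s`. -/
def localLim (s : ℝ) : Filter (ℕ × ℝ) :=
  (atTop ×ˢ atTop) ⊓ comap (fun p : ℕ × ℝ => (p.1 : ℝ) / p.2) (𝓝 s)

/-- The interval `[-M, M]` as a subset of the complex plane. -/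
def realInterval (M : ℝ) : Set ℂ := (fun t : ℝ => (t : ℂ)) '' Set.Icc (-M) M

/-! ### The quadratic eigenvalue problem -/

/-- The matrix `z A^* + B + z⁻¹ A - x I`. -/
def pencil (A B : Matrix (Fin r) (Fin r) ℂ) (z x : ℂ) : Matrix (Fin r) (Fin r) ℂ :=
  z • Aᴴ + B + z⁻¹ • A - x • (1 : Matrix (Fin r) (Fin r) ℂ)

/-- The function `f(z, x) = det (z A^* + B + z⁻¹ A - x I)`. -/
def symbolDet (A B : Matrix (Fin r) (Fin r) ℂ) (z x : ℂ) : ℂ := (pencil A B z x).det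

/-- The polynomial `Z^r f(Z, x)` in the variable `Z`, written as
`det (Z^2 A^* + Z (B - x I) + A)`. -/
def symbolPoly (A B : Matrix (Fin r) (Fin r) ℂ) (x : ℂ) : Polynomial ℂ :=
  (((Polynomial.X : Polynomial ℂ) ^ 2) • (Aᴴ).map Polynomial.C
    + (Polynomial.X : Polynomial ℂ) •
      (B - x • (1 : Matrix (Fin r) (Fin r) ℂ)).map Polynomial.C
    + A.map Polynomial.C).det

theorem symbolPoly_eval (A B : Matrix (Fin r) (Fin r) ℂ) (x z : ℂ) (hz : z ≠ 0) :
    (symbolPoly A B x).eval z = z ^ r * symbolDet A B z x := by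
  have h1 : z ^ r * symbolDet A B z x = (z • pencil A B z x).det := by
    rw [Matrix.det_smul, Fintype.card_fin, symbolDet]
  rw [h1, symbolPoly, ← Polynomial.coe_evalRingHom, RingHom.map_det]
  congr 1
  ext i j
  simp only [pencil, RingHom.mapMatrix_apply, Matrix.map_apply, Matrix.add_apply,
    Matrix.sub_apply, Matrix.smul_apply, smul_eq_mul, Polynomial.coe_evalRingHom,
    Polynomial.eval_add, Polynomial.eval_mul, Polynomial.eval_pow, Polynomial.eval_X,
    Polynomial.eval_C]
  field_simp
  ring

/-- `z` lists the `2r` roots `z_1(x), …, z_{2r}(x)` of `f(z, x) = 0`, with multiplicities, by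
increasing modulus (ties being broken in an arbitrary way). -/
structure IsRootLabelling (A B : Matrix (Fin r) (Fin r) ℂ) (x : ℂ)
    (z : Fin (2 * r) → ℂ) : Prop where
  roots_eq : (Finset.univ : Finset (Fin (2 * r))).val.map z = (symbolPoly A B x).roots
  monotone_norm : Monotone fun k => ‖z k‖

/-- The geometric multiplicity `d(z, x)`. -/
def geomMult (A B : Matrix (Fin r) (Fin r) ℂ) (z x : ℂ) : ℕ :=
  Module.finrank ℂ (LinearMap.ker (pencil A B z x).mulVecLin)

/-- The algebraic multiplicity `m₁(z, x)`: the largest `k` such that `(Z - z)^k` divides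
`Z^r f(Z, x)`. -/
def algMult (A B : Matrix (Fin r) (Fin r) ℂ) (z x : ℂ) : ℕ :=
  (symbolPoly A B x).rootMultiplicity z

/-- `z` is an ordered list of the roots `z_k(x)`, and `v` is a corresponding choice of null vectors
`v_k(x)` of unit Euclidean norm which takes the multiplicities into account: the vectors that
belong to one and the same root `z` span a space of dimension `d(z, x) = m₁(z, x)`. -/
structure IsEigenSystem (A B : Matrix (Fin r) (Fin r) ℂ) (x : ℂ)
    (z : Fin (2 * r) → ℂ) (v : Fin (2 * r) → Fin r → ℂ) : Prop where
  labelling : IsRootLabelling A B x z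
  unit_norm : ∀ k, ∑ i, ‖v k i‖ ^ 2 = 1
  null_vector : ∀ k, (pencil A B (z k) x) *ᵥ (v k) = 0
  span_dim : ∀ k,
    Module.finrank ℂ (Submodule.span ℂ (v '' {l | z l = z k})) = geomMult A B (z k) x
  geom_eq_alg : ∀ k, geomMult A B (z k) x = algMult A B (z k) x

/-- The exceptional set `S`: the points `x` for which the vectors `v_k(x)` cannot be chosen with
the right multiplicities. -/
def exceptionalSet (A B : Matrix (Fin r) (Fin r) ℂ) : Set ℂ :=
  {x | ¬ ∃ (z : Fin (2 * r) → ℂ) (v : Fin (2 * r) → Fin r → ℂ), IsEigenSystem A B x z v}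

/-- The index `k ∈ {1, …, r}` as an element of `{1, …, 2r}`. -/
def smallIdx (k : Fin r) : Fin (2 * r) := Fin.castLE (by omega) k

/-- A complex matrix is diagonalizable if it is similar to a diagonal matrix. -/
def IsDiagonalizable (R : Matrix (Fin r) (Fin r) ℂ) : Prop :=
  ∃ (V : Matrix (Fin r) (Fin r) ℂ) (d : Fin r → ℂ),
    V.det ≠ 0 ∧ R = V * Matrix.diagonal d * V⁻¹

end RatioAsymptotics

end

noncomputable section

namespace RatioAsymptotics

variable {r : ℕ}

/-! ### The filter of the local limit -/

/-! The blocks `P_k P_{n+1}⁻¹ A_{n+1}⁻¹`, `k ≤ n`, form the last block column of the resolvent of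
the truncated block Jacobi matrix. That matrix is Hermitian and its eigenvalues are zeros of `det
P_{n+1}`, so its spectrum lies in `[-M, M]`. A moment in the last block column, at a fixed distance
from the bottom, involves only finitely many coefficients with index near `n`, hence converges;
Weierstrass approximation of `(x - t)⁻¹` on `[-M, M]` carries this over to the resolvent
(`exists_green_limit`). With `W` the limit of the corner block, the ratio tends to `R = W A`.

Dividing the recurrence by `P_{n+1}` shows that `x R = A + B R + A^* R²` (`ratio_limit_quadratic`),
that is, `Z² A^* + Z (B - x) + A = (Z A^* + A^* R + B - x)(Z - R)`. Resolvent columns are bounded in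
`ℓ²`, and counted from the bottom their blocks tend to `R^{k+1} A⁻¹`; so `R^m → 0` and the
eigenvalues of `R` lie in the open unit disc. The symmetry `W(x̄) = W(x)^*` puts the zeros of the
left factor outside the closed disc (`one_lt_norm_of_leftFactor_root`). The unit circle thus
separates `z_1, …, z_r`, the eigenvalues of `R`, from the other roots. This gives the determinant
limit, and the null vectors belonging to small roots are eigenvectors of `R`.

For the finiteness of the exceptional set, let `Q` be a radical of the symbol with denominators in
`x` cleared. On `|w| = 1` the matrix `w A^* + B + w⁻¹ A` is Hermitian, so it is annihilated by `Q`
itself, not just by a power of it. Extended from the circle to a polynomial identity, this says that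
`Z² A^* + Z (B - x) + A` divides `Z^d Q(x, Z)` times the identity (`exists_scalar_multiple`). Where
`Q(x, ·)` is separable, a rank count forces geometric and algebraic multiplicities to agree; it is
separable for all but finitely many `x`. -/

theorem tendsto_localLim_iff {α : Type*} {l : Filter α} {f : α → ℕ × ℝ} {s : ℝ} :
    Tendsto f l (localLim s) ↔ Tendsto (fun a => (f a).1) l atTop ∧
      Tendsto (fun a => (f a).2) l atTop ∧
      Tendsto (fun a => ((f a).1 : ℝ) / (f a).2) l (𝓝 s) := by
  simp only [localLim, tendsto_inf, tendsto_prod_iff', tendsto_comap_iff, and_assoc]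
  rfl

theorem localLim_fst (s : ℝ) : Tendsto (fun p : ℕ × ℝ => p.1) (localLim s) atTop :=
  (tendsto_localLim_iff.1 tendsto_id).1

theorem localLim_snd (s : ℝ) : Tendsto (fun p : ℕ × ℝ => p.2) (localLim s) atTop :=
  (tendsto_localLim_iff.1 tendsto_id).2.1

/-- Uniqueness of limits along this filter rests on this; the path `N = n / s` is a witness. -/
theorem localLim_neBot {s : ℝ} (hs : 0 < s) : (localLim s).NeBot := by
  have h : Tendsto (fun n : ℕ => (n, (n : ℝ) / s)) atTop (localLim s) := by
    refine tendsto_localLim_iff.2 ⟨tendsto_id,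
      tendsto_natCast_atTop_atTop.atTop_div_const hs, ?_⟩
    refine tendsto_const_nhds.congr' ?_
    filter_upwards [eventually_gt_atTop 0] with n hn
    have : (n : ℝ) ≠ 0 := by positivity
    field_simp
  exact h.neBot

theorem tendsto_localLim_succ (s : ℝ) :
    Tendsto (fun p : ℕ × ℝ => (p.1 + 1, p.2)) (localLim s) (localLim s) := by
  have h := tendsto_localLim_iff.1 (tendsto_id : Tendsto id (localLim s) (localLim s))
  refine tendsto_localLim_iff.2 ⟨(tendsto_add_atTop_nat 1).comp h.1, h.2.1, ?_⟩
  have h2 : Tendsto (fun p : ℕ × ℝ => 1 / p.2) (localLim s) (𝓝 0) :=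
    tendsto_const_nhds.div_atTop h.2.1
  have h3 := h.2.2.add h2
  rw [add_zero] at h3
  refine h3.congr fun p => ?_
  simp only [id]
  push_cast
  ring

theorem tendsto_localLim_sub (s : ℝ) (a : ℕ) :
    Tendsto (fun p : ℕ × ℝ => (p.1 - a, p.2)) (localLim s) (localLim s) := by
  have h := tendsto_localLim_iff.1 (tendsto_id : Tendsto id (localLim s) (localLim s))
  refine tendsto_localLim_iff.2 ⟨(tendsto_sub_atTop_nat a).comp h.1, h.2.1, ?_⟩
  have h2 : Tendsto (fun p : ℕ × ℝ => (a : ℝ) / p.2) (localLim s) (𝓝 0) :=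
    tendsto_const_nhds.div_atTop h.2.1
  have h3 := h.2.2.sub h2
  rw [sub_zero] at h3
  refine h3.congr' ?_
  filter_upwards [h.1.eventually_ge_atTop a] with p hp
  simp only [id] at hp ⊢
  rw [Nat.cast_sub hp]
  ring

/-! ### The interval -/

theorem isClosed_realInterval (M : ℝ) : IsClosed (realInterval M) :=
  (isCompact_Icc.image Complex.continuous_ofReal).isClosed

theorem mem_realInterval_ofReal {M t : ℝ} : (t : ℂ) ∈ realInterval M ↔ t ∈ Set.Icc (-M) M := by
  simp [realInterval]

theorem conj_mem_realInterval {M : ℝ} {x : ℂ} :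
    star x ∈ realInterval M ↔ x ∈ realInterval M := by
  constructor
  · rintro ⟨t, ht, h⟩
    refine ⟨t, ht, ?_⟩
    have h2 := congrArg star h
    simpa using h2
  · rintro ⟨t, ht, rfl⟩
    exact ⟨t, ht, by simp⟩

theorem exists_dist_realInterval {M : ℝ} {x : ℂ} (hx : x ∉ realInterval M) :
    ∃ d > 0, ∀ y ∈ Metric.ball x d, ∀ t ∈ Set.Icc (-M) M, d ≤ ‖y - (t : ℂ)‖ := by
  obtain ⟨e, he, h⟩ := Metric.isOpen_iff.1 (isClosed_realInterval M).isOpen_compl x hx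
  refine ⟨e / 2, by positivity, fun y hy t ht => ?_⟩
  by_contra! hlt
  have h2 : (t : ℂ) ∈ Metric.ball x e := by
    rw [Metric.mem_ball, dist_comm]
    have h3 := dist_triangle x y (t : ℂ)
    rw [Metric.mem_ball, dist_comm] at hy
    rw [dist_eq_norm y] at h3
    linarith
  exact h h2 (mem_realInterval_ofReal.2 ht)

/-- Real Weierstrass approximation, applied to the real and imaginary parts. -/
theorem exists_polynomial_approx_inv {M : ℝ} {x : ℂ} (hx : x ∉ realInterval M) {ε : ℝ}
    (hε : 0 < ε) : ∃ p : Polynomial ℂ, ∀ t ∈ Set.Icc (-M) M,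
      ‖(x - (t : ℂ))⁻¹ - p.eval (t : ℂ)‖ ≤ ε := by
  have hne : ∀ t ∈ Set.Icc (-M) M, x - (t : ℂ) ≠ 0 := fun t ht h => by
    rw [sub_eq_zero] at h
    exact hx (h ▸ mem_realInterval_ofReal.2 ht)
  have hc : ContinuousOn (fun t : ℝ => (x - (t : ℂ))⁻¹) (Set.Icc (-M) M) :=
    ContinuousOn.inv₀ (by fun_prop) hne
  obtain ⟨p, hp⟩ := exists_polynomial_near_of_continuousOn (-M) M _
    (Complex.continuous_re.comp_continuousOn hc) (ε / 2) (by positivity)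
  obtain ⟨q, hq⟩ := exists_polynomial_near_of_continuousOn (-M) M _
    (Complex.continuous_im.comp_continuousOn hc) (ε / 2) (by positivity)
  refine ⟨p.map Complex.ofRealHom + Polynomial.C Complex.I * q.map Complex.ofRealHom,
    fun t ht => ?_⟩
  have e1 : ∀ p : Polynomial ℝ, (p.map Complex.ofRealHom).eval (t : ℂ) = (p.eval t : ℝ) := by
    intro p
    rw [Polynomial.eval_map, ← Complex.ofRealHom_eq_coe, Polynomial.eval₂_hom]
    rfl
  rw [Polynomial.eval_add, Polynomial.eval_mul, Polynomial.eval_C, e1, e1]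
  refine (Complex.norm_le_abs_re_add_abs_im _).trans ?_
  have h1 := hp t ht
  have h2 := hq t ht
  rw [abs_sub_comm] at h1 h2
  simp at h1 h2 ⊢
  linarith

/-! ### The truncated block Jacobi matrix -/

/-- The truncated block Jacobi matrix with diagonal blocks `b 0, …, b n` and upper diagonal blocks
`a 1, …, a n`. -/
def jacobi (a b : ℕ → Matrix (Fin r) (Fin r) ℂ) (n : ℕ) :
    Matrix (Fin (n + 1) × Fin r) (Fin (n + 1) × Fin r) ℂ :=
  Matrix.of fun p q =>
    (if (q.1 : ℕ) = p.1 + 1 then a (p.1 + 1) p.2 q.2 else 0) +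
    (if (q.1 : ℕ) = p.1 then b p.1 p.2 q.2 else 0) +
    (if (p.1 : ℕ) = q.1 + 1 then star (a p.1 q.2 p.2) else 0)

theorem jacobi_isHermitian {a b : ℕ → Matrix (Fin r) (Fin r) ℂ} (hb : ∀ k, (b k).IsHermitian)
    (n : ℕ) : (jacobi a b n).IsHermitian := by
  ext ⟨k, i⟩ ⟨l, j⟩
  simp only [jacobi, Matrix.conjTranspose_apply, Matrix.of_apply, star_add]
  have h1 : star (b l j i) = b l i j := (hb l).apply i j
  by_cases hkl : (l : ℕ) = k
  · rw [hkl] at h1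
    simp only [hkl, if_true, show ¬ ((k : ℕ) = k + 1) by omega, if_false, star_zero, zero_add,
      add_zero, h1]
  · have h' : (k : ℕ) ≠ l := fun h => hkl h.symm
    simp only [hkl, h', if_false, star_zero, add_zero]
    by_cases h2 : (l : ℕ) = k + 1
    · simp only [h2, if_true, star_star]
      rw [if_neg (by omega), if_neg (by omega), star_zero, zero_add, add_zero]
    · by_cases h3 : (k : ℕ) = l + 1
      · simp only [h3, if_true]
        rw [if_neg (by omega), if_neg (by omega), star_zero, zero_add, add_zero]
      · simp [h2, h3]

theorem jacobi_mulVec (a b : ℕ → Matrix (Fin r) (Fin r) ℂ) (n : ℕ) (φ : ℕ → Fin r → ℂ)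
    (k : Fin (n + 1)) (i : Fin r) :
    (jacobi a b n *ᵥ fun p => φ p.1 p.2) (k, i) =
      (if (k : ℕ) + 1 ≤ n then (a (k + 1) *ᵥ φ (k + 1)) i else 0) + (b k *ᵥ φ k) i +
      (if 1 ≤ (k : ℕ) then ((a k)ᴴ *ᵥ φ (k - 1)) i else 0) := by
  have hk := k.2
  have key : ∀ (m : ℕ) (g : ℕ → Fin r → ℂ),
      ∑ l : Fin (n + 1), (if (l : ℕ) = m then ∑ j, g l j else 0)
        = if m ≤ n then ∑ j, g m j else 0 := by
    intro m g
    rw [Fin.sum_univ_eq_sum_range (fun l => if l = m then ∑ j, g l j else 0) (n + 1)]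
    rw [Finset.sum_ite_eq' (Finset.range (n + 1)) m (fun l => ∑ j, g l j)]
    simp
  simp only [Matrix.mulVec, dotProduct, Fintype.sum_prod_type, jacobi, Matrix.of_apply, add_mul,
    Finset.sum_add_distrib, ite_mul, zero_mul]
  congr 1
  · congr 1
    · rw [← key (k + 1) (fun l j => a (k + 1) i j * φ l j)]
      refine Finset.sum_congr rfl fun l _ => ?_
      split_ifs <;> simp
    · have h1 := key k (fun l j => b k i j * φ l j)
      rw [if_pos (by omega)] at h1
      rw [← h1]
      refine Finset.sum_congr rfl fun l _ => ?_
      split_ifs <;> simp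
  · rcases Nat.eq_zero_or_pos (k : ℕ) with h0 | h0
    · rw [if_neg (by omega)]
      refine Finset.sum_eq_zero fun l _ => Finset.sum_eq_zero fun j _ => ?_
      rw [if_neg (by omega)]
    · rw [if_pos (show 1 ≤ (k : ℕ) from h0)]
      have h1 := key (k - 1) (fun l j => star (a k j i) * φ l j)
      rw [if_pos (by omega)] at h1
      refine Eq.trans ?_ h1
      refine Finset.sum_congr rfl fun l _ => ?_
      by_cases h2 : (l : ℕ) = k - 1
      · rw [if_pos h2]
        refine Finset.sum_congr rfl fun j _ => ?_
        rw [if_pos (by omega)]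
      · rw [if_neg h2]
        refine Finset.sum_eq_zero fun j _ => ?_
        rw [if_neg (by omega)]

/-- Extension by zero of a block vector to all indices. -/
def extendZero {n : ℕ} (ψ : Fin (n + 1) × Fin r → ℂ) (k : ℕ) (i : Fin r) : ℂ :=
  if h : k < n + 1 then ψ (⟨k, h⟩, i) else 0

theorem extendZero_restrict {n : ℕ} (ψ : Fin (n + 1) × Fin r → ℂ) :
    (fun p : Fin (n + 1) × Fin r => extendZero ψ p.1 p.2) = ψ := by
  ext ⟨k, i⟩
  simp only [extendZero, dif_pos k.2]

/-- The rows of the eigenvalue equation are the recurrence, so an eigenvector has blocks `P_k φ_0`.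
The last row lacks the term `A_{n+1} P_{n+1} φ_0`, which must therefore vanish, and `φ_0 ≠ 0`. -/
theorem det_orthPoly_eq_zero_of_jacobi {a b : ℕ → Matrix (Fin r) (Fin r) ℂ}
    (ha : ∀ n, 1 ≤ n → (a n).det ≠ 0) (n : ℕ) {x : ℂ} {ψ : Fin (n + 1) × Fin r → ℂ}
    (hψ : ψ ≠ 0) (hev : jacobi a b n *ᵥ ψ = x • ψ) : (orthPoly a b (n + 1) x).det = 0 := by
  set φ := extendZero ψ with hφ
  have hrow : ∀ k, k ≤ n → x • φ k =
      (if k + 1 ≤ n then a (k + 1) *ᵥ φ (k + 1) else 0) + b k *ᵥ φ k +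
      (if 1 ≤ k then (a k)ᴴ *ᵥ φ (k - 1) else 0) := by
    intro k hk
    ext i
    have h1 := jacobi_mulVec a b n φ ⟨k, by omega⟩ i
    rw [hφ, extendZero_restrict, hev, ← hφ] at h1
    have h2 : (x • ψ) (⟨k, by omega⟩, i) = (x • φ k) i := by
      simp [hφ, extendZero, show k < n + 1 by omega]
    rw [← h2, h1]
    simp only [Pi.add_apply]
    congr 1
    · congr 1
      split_ifs <;> rfl
    · split_ifs <;> rfl
  have hinj : ∀ k, 1 ≤ k → Function.Injective (a k).mulVec := fun k hk =>
    Matrix.mulVec_injective_of_isUnit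
      ((Matrix.isUnit_iff_isUnit_det _).2 (isUnit_iff_ne_zero.2 (ha k hk)))
  have hP0 : ∀ v : Fin r → ℂ, a 1 *ᵥ (orthPoly a b 1 x *ᵥ v) =
      x • (orthPoly a b 0 x *ᵥ v) - b 0 *ᵥ (orthPoly a b 0 x *ᵥ v) := by
    intro v
    have h1 := congrArg (fun X => X *ᵥ v) (orthPoly_recurrence_zero a b ha x)
    simp only [Matrix.add_mulVec, ← Matrix.mulVec_mulVec, Matrix.smul_mulVec] at h1
    rw [h1]; abel
  have hP : ∀ k, ∀ v : Fin r → ℂ, a (k + 2) *ᵥ (orthPoly a b (k + 2) x *ᵥ v) =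
      x • (orthPoly a b (k + 1) x *ᵥ v) - b (k + 1) *ᵥ (orthPoly a b (k + 1) x *ᵥ v)
        - (a (k + 1))ᴴ *ᵥ (orthPoly a b k x *ᵥ v) := by
    intro k v
    have h1 := congrArg (fun X => X *ᵥ v) (orthPoly_recurrence_succ a b ha k x)
    simp only [Matrix.add_mulVec, ← Matrix.mulVec_mulVec, Matrix.smul_mulVec] at h1
    rw [h1]; abel
  have hall : ∀ k, k ≤ n → φ k = orthPoly a b k x *ᵥ φ 0 := by
    intro k
    induction k using Nat.strong_induction_on with
    | _ k ih =>
      intro hk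
      match k with
      | 0 => simp [orthPoly]
      | 1 =>
        apply hinj 1 le_rfl
        have h1 := hrow 0 (by omega)
        simp only [zero_add, hk, if_true, show ¬ (1 ≤ 0) by omega, if_false, add_zero] at h1
        rw [hP0]
        simp only [orthPoly, Matrix.one_mulVec]
        rw [h1]; abel
      | m + 2 =>
        apply hinj (m + 2) (by omega)
        have h1 := hrow (m + 1) (by omega)
        simp only [show m + 1 + 1 = m + 2 by rfl, hk, if_true, show 1 ≤ m + 1 by omega,
          show m + 1 - 1 = m by omega] at h1
        rw [hP, ← ih m (by omega) (by omega), ← ih (m + 1) (by omega) (by omega), h1]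
        abel
  have hlast : a (n + 1) *ᵥ (orthPoly a b (n + 1) x *ᵥ φ 0) = 0 := by
    have h1 := hrow n le_rfl
    match n with
    | 0 =>
      rw [hP0]
      simp only [zero_add, show ¬ (1 ≤ 0) by omega, if_false, add_zero] at h1
      simp only [orthPoly, Matrix.one_mulVec]
      rw [h1, sub_self]
    | m + 1 =>
      rw [hP, ← hall m (by omega), ← hall (m + 1) le_rfl]
      simp only [show ¬ (m + 1 + 1 ≤ m + 1) by omega, if_false, show 1 ≤ m + 1 by omega,
          show m + 1 - 1 = m by omega, zero_add, if_true] at h1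
      rw [h1]; abel
  have hz : orthPoly a b (n + 1) x *ᵥ φ 0 = 0 := by
    apply hinj (n + 1) (by omega)
    rw [hlast]; simp
  have h0 : φ 0 ≠ 0 := by
    intro h0
    apply hψ
    ext ⟨k, i⟩
    have h1 := hall k (by omega)
    rw [h0, Matrix.mulVec_zero] at h1
    have h2 : φ k i = ψ (k, i) := by simp only [hφ, extendZero, dif_pos k.2]
    rw [← h2, h1]; rfl
  exact Matrix.exists_mulVec_eq_zero_iff.1 ⟨_, h0, hz⟩

/-- The block column `P_k P_{n+1}⁻¹ A_{n+1}⁻¹`, `0 ≤ k ≤ n`. -/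
def greenColumn (a b : ℕ → Matrix (Fin r) (Fin r) ℂ) (n : ℕ) (x : ℂ) (k : ℕ) :
    Matrix (Fin r) (Fin r) ℂ :=
  orthPoly a b k x * (orthPoly a b (n + 1) x)⁻¹ * (a (n + 1))⁻¹

/-- The column satisfies the recurrence in every row. Truncation drops only `A_{n+1}` times block `n
+ 1` from the last row, and that term is the identity. -/
theorem sub_jacobi_mulVec_greenColumn {a b : ℕ → Matrix (Fin r) (Fin r) ℂ}
    (ha : ∀ n, 1 ≤ n → (a n).det ≠ 0) (n : ℕ) {x : ℂ}
    (hx : (orthPoly a b (n + 1) x).det ≠ 0) (j : Fin r) :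
    (x • (1 : Matrix (Fin (n + 1) × Fin r) (Fin (n + 1) × Fin r) ℂ) - jacobi a b n) *ᵥ
      (fun p => greenColumn a b n x p.1 p.2 j) = Pi.single (Fin.last n, j) 1 := by
  have hu : IsUnit (orthPoly a b (n + 1) x).det := isUnit_iff_ne_zero.2 hx
  have hua : IsUnit (a (n + 1)).det := isUnit_iff_ne_zero.2 (ha _ (by omega))
  have hlast : a (n + 1) * greenColumn a b n x (n + 1) = 1 := by
    rw [greenColumn, Matrix.mul_nonsing_inv _ hu, one_mul, Matrix.mul_nonsing_inv _ hua]
  have hrow : ∀ k : ℕ, x • greenColumn a b n x k = a (k + 1) * greenColumn a b n x (k + 1) +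
      b k * greenColumn a b n x k +
      (if 1 ≤ k then (a k)ᴴ * greenColumn a b n x (k - 1) else 0) := by
    intro k
    match k with
    | 0 =>
      have h1 := orthPoly_recurrence_zero a b ha x
      simp only [greenColumn, ← smul_mul_assoc]
      rw [h1]
      simp [mul_assoc, add_mul]
    | k + 1 =>
      have h1 := orthPoly_recurrence_succ a b ha k x
      simp only [greenColumn, ← smul_mul_assoc]
      rw [h1]
      simp [mul_assoc, add_mul]
  ext ⟨k, i⟩
  have hJ := jacobi_mulVec a b n (fun k i => greenColumn a b n x k i j) k i
  have hcol : ∀ (c : Matrix (Fin r) (Fin r) ℂ) (l : ℕ),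
      (c *ᵥ fun i => greenColumn a b n x l i j) i = (c * greenColumn a b n x l) i j :=
    fun c l => rfl
  rw [hcol, hcol, hcol] at hJ
  have h1 := congrFun (congrFun (hrow k) i) j
  rw [Matrix.sub_mulVec, Pi.sub_apply, hJ, Matrix.smul_mulVec, Matrix.one_mulVec]
  have h2 : (x • fun p : Fin (n + 1) × Fin r => greenColumn a b n x p.1 p.2 j) (k, i)
      = (x • greenColumn a b n x k) i j := rfl
  rw [h2, h1]
  have h3 : ∀ (c : Prop) [Decidable c] (X : Matrix (Fin r) (Fin r) ℂ),
      (if c then X else 0) i j = if c then X i j else 0 := by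
    intro c _ X; split_ifs <;> rfl
  simp only [Matrix.add_apply, h3]
  by_cases hkn : (k : ℕ) + 1 ≤ n
  · have hne : (k, i) ≠ (Fin.last n, j) := fun h => by
      have := congrArg (fun p : Fin (n + 1) × Fin r => (p.1 : ℕ)) h
      simp only [Fin.val_last] at this
      omega
    rw [if_pos hkn, Pi.single_eq_of_ne hne]
    ring
  · have hk : (k : ℕ) = n := by omega
    have hk' : k = Fin.last n := Fin.ext hk
    subst hk'
    rw [if_neg hkn, Fin.val_last, hlast, Matrix.one_apply, Pi.single_apply]
    simp

/-- The entries of a unitary conjugate of a diagonal matrix. -/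
theorem unitary_conj_entry {ι : Type*} [Fintype ι] [DecidableEq ι] (U : Matrix ι ι ℂ) (g : ι → ℂ)
    (i j : ι) : (U * Matrix.diagonal g * Uᴴ) i j = ∑ m, U i m * g m * star (U j m) := by
  rw [Matrix.mul_apply]
  simp [Matrix.mul_diagonal]

/-- The columns of a unitary conjugate of a diagonal matrix are bounded by its entries. -/
theorem unitary_conj_column_le {ι : Type*} [Fintype ι] [DecidableEq ι] {U : Matrix ι ι ℂ}
    (hU : Uᴴ * U = 1) (hU' : U * Uᴴ = 1) {g : ι → ℂ} {c : ℝ} (hg : ∀ m, ‖g m‖ ≤ c) (j : ι) :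
    ∑ i, ‖(U * Matrix.diagonal g * Uᴴ) i j‖ ^ 2 ≤ c ^ 2 := by
  set T := U * Matrix.diagonal g * Uᴴ with hT
  -- The squared column norm is a diagonal entry of `Tᴴ T`, hence an average of the `‖g m‖²` with
  -- weights `‖U j m‖²` of sum one.
  have h1 : Tᴴ * T = U * Matrix.diagonal (fun m => star (g m) * g m) * Uᴴ := by
    rw [← Matrix.diagonal_mul_diagonal, hT]
    simp only [Matrix.conjTranspose_mul, Matrix.conjTranspose_conjTranspose,
      Matrix.diagonal_conjTranspose]
    calc U * (Matrix.diagonal (star g) * Uᴴ) * (U * Matrix.diagonal g * Uᴴ)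
        = U * Matrix.diagonal (star g) * (Uᴴ * U) * Matrix.diagonal g * Uᴴ := by
          simp only [mul_assoc]
      _ = _ := by rw [hU, mul_one]; simp only [mul_assoc]; rfl
  have h2 : ((∑ i, ‖T i j‖ ^ 2 : ℝ) : ℂ) = (Tᴴ * T) j j := by
    rw [Matrix.mul_apply]
    push_cast
    refine Finset.sum_congr rfl fun i _ => ?_
    rw [Matrix.conjTranspose_apply, ← Complex.conj_mul']
    rfl
  have h3 : (Tᴴ * T) j j = ((∑ m, ‖U j m‖ ^ 2 * ‖g m‖ ^ 2 : ℝ) : ℂ) := by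
    rw [h1, unitary_conj_entry]
    push_cast
    refine Finset.sum_congr rfl fun m _ => ?_
    rw [← Complex.conj_mul', ← Complex.conj_mul']
    simp only [Complex.star_def]
    ring
  have h4 : (∑ m, ‖U j m‖ ^ 2 : ℝ) = 1 := by
    have h5 : ((∑ m, ‖U j m‖ ^ 2 : ℝ) : ℂ) = (U * Uᴴ) j j := by
      rw [Matrix.mul_apply]
      push_cast
      refine Finset.sum_congr rfl fun i _ => ?_
      rw [Matrix.conjTranspose_apply, ← Complex.mul_conj']
      rfl
    rw [hU', Matrix.one_apply_eq] at h5
    exact_mod_cast h5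
  have h5 : (∑ i, ‖T i j‖ ^ 2 : ℝ) = ∑ m, ‖U j m‖ ^ 2 * ‖g m‖ ^ 2 := by
    exact_mod_cast h2.trans h3
  rw [h5]
  calc ∑ m, ‖U j m‖ ^ 2 * ‖g m‖ ^ 2 ≤ ∑ m, ‖U j m‖ ^ 2 * c ^ 2 := by
        gcongr with m; exact hg m
    _ = c ^ 2 := by rw [← Finset.sum_mul, h4, one_mul]

theorem unitary_conj_entry_le {ι : Type*} [Fintype ι] [DecidableEq ι] {U : Matrix ι ι ℂ}
    (hU : Uᴴ * U = 1) (hU' : U * Uᴴ = 1) {g : ι → ℂ} {c : ℝ} (hc : 0 ≤ c)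
    (hg : ∀ m, ‖g m‖ ≤ c) (i j : ι) : ‖(U * Matrix.diagonal g * Uᴴ) i j‖ ≤ c := by
  refine (sq_le_sq₀ (norm_nonneg _) hc).1 (le_trans ?_ (unitary_conj_column_le hU hU' hg j))
  exact Finset.single_le_sum (f := fun i => ‖(U * Matrix.diagonal g * Uᴴ) i j‖ ^ 2)
    (fun _ _ => by positivity) (Finset.mem_univ i)

theorem unitary_conj_pow {ι : Type*} [Fintype ι] [DecidableEq ι] {U : Matrix ι ι ℂ}
    (hU : Uᴴ * U = 1) (hU' : U * Uᴴ = 1) (g : ι → ℂ) (k : ℕ) :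
    (U * Matrix.diagonal g * Uᴴ) ^ k = U * Matrix.diagonal (g ^ k) * Uᴴ := by
  induction k with
  | zero => simp [hU']
  | succ k ih =>
    rw [pow_succ, ih, pow_succ]
    calc U * Matrix.diagonal (g ^ k) * Uᴴ * (U * Matrix.diagonal g * Uᴴ)
        = U * Matrix.diagonal (g ^ k) * (Uᴴ * U) * Matrix.diagonal g * Uᴴ := by
          simp only [mul_assoc]
      _ = _ := by
        rw [hU, mul_one, mul_assoc U, Matrix.diagonal_mul_diagonal]; rfl

/-- If the zeros of `det P_{n+1}` lie in `[-M, M]`, the truncated Jacobi matrix has a spectral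
decomposition supported there, which represents `P_k P_{n+1}⁻¹ A_{n+1}⁻¹`. -/
theorem exists_spectral_representation {a b : ℕ → Matrix (Fin r) (Fin r) ℂ}
    (ha : ∀ n, 1 ≤ n → (a n).det ≠ 0) (hb : ∀ k, (b k).IsHermitian) {M : ℝ} (n : ℕ)
    (hz : ∀ x, (orthPoly a b (n + 1) x).det = 0 → x ∈ realInterval M) :
    ∃ (U : Matrix (Fin (n + 1) × Fin r) (Fin (n + 1) × Fin r) ℂ)
      (t : Fin (n + 1) × Fin r → ℝ), Uᴴ * U = 1 ∧ U * Uᴴ = 1 ∧ (∀ m, t m ∈ Set.Icc (-M) M) ∧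
      (∀ k, jacobi a b n ^ k = U * Matrix.diagonal (fun m => (t m : ℂ) ^ k) * Uᴴ) ∧
      ∀ x, x ∉ realInterval M → ∀ k i j, greenColumn a b n x (k : Fin (n + 1)) i j =
        (U * Matrix.diagonal (fun m => (x - t m)⁻¹) * Uᴴ) (k, i) (Fin.last n, j) := by
  have hJ := jacobi_isHermitian (a := a) hb n
  set U : Matrix (Fin (n + 1) × Fin r) (Fin (n + 1) × Fin r) ℂ :=
    hJ.eigenvectorUnitary.1 with hUdef
  have hU : Uᴴ * U = 1 := Unitary.coe_star_mul_self hJ.eigenvectorUnitary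
  have hU' : U * Uᴴ = 1 := Unitary.coe_mul_star_self hJ.eigenvectorUnitary
  have hspec : jacobi a b n = U * Matrix.diagonal (fun m => (hJ.eigenvalues m : ℂ)) * Uᴴ := by
    have h := hJ.spectral_theorem
    rw [Unitary.conjStarAlgAut_apply] at h
    exact h
  have hmem : ∀ m, hJ.eigenvalues m ∈ Set.Icc (-M) M := by
    intro m
    rw [← mem_realInterval_ofReal]
    apply hz
    refine det_orthPoly_eq_zero_of_jacobi ha n
      (ψ := WithLp.ofLp (hJ.eigenvectorBasis m)) ?_ ?_
    · intro h
      exact hJ.eigenvectorBasis.orthonormal.ne_zero m (by ext i; exact congrFun h i)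
    · have h := hJ.mulVec_eigenvectorBasis m
      rw [h]
      ext i
      simp
  refine ⟨U, hJ.eigenvalues, hU, hU', hmem, fun k => ?_, fun x hx k i j => ?_⟩
  · conv_lhs => rw [hspec]
    rw [unitary_conj_pow hU hU']
    rfl
  · have hne : ∀ m, x - (hJ.eigenvalues m : ℂ) ≠ 0 := fun m h => by
      rw [sub_eq_zero] at h
      exact hx (h ▸ mem_realInterval_ofReal.2 (hmem m))
    have hdet : (orthPoly a b (n + 1) x).det ≠ 0 := fun h => hx (hz x h)
    have h1 := sub_jacobi_mulVec_greenColumn ha n hdet j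
    have h2 : x • (1 : Matrix (Fin (n + 1) × Fin r) (Fin (n + 1) × Fin r) ℂ) - jacobi a b n =
        U * Matrix.diagonal (fun m => x - (hJ.eigenvalues m : ℂ)) * Uᴴ := by
      have h3 : Matrix.diagonal (fun m => x - (hJ.eigenvalues m : ℂ)) =
          x • 1 - Matrix.diagonal (fun m => (hJ.eigenvalues m : ℂ)) := by
        rw [Matrix.smul_one_eq_diagonal, Matrix.diagonal_sub]
      rw [h3, mul_sub, sub_mul, ← hspec]
      simp [hU']
    set S := U * Matrix.diagonal (fun m => (x - (hJ.eigenvalues m : ℂ))⁻¹) * Uᴴ with hS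
    have h4 : S * (U * Matrix.diagonal (fun m => x - (hJ.eigenvalues m : ℂ)) * Uᴴ) = 1 := by
      calc S * (U * Matrix.diagonal (fun m => x - (hJ.eigenvalues m : ℂ)) * Uᴴ)
          = U * Matrix.diagonal (fun m => (x - (hJ.eigenvalues m : ℂ))⁻¹) * (Uᴴ * U) *
            Matrix.diagonal (fun m => x - (hJ.eigenvalues m : ℂ)) * Uᴴ := by
            simp only [hS, mul_assoc]
        _ = 1 := by
          rw [hU, mul_one, mul_assoc U, Matrix.diagonal_mul_diagonal]
          have : (fun m => (x - (hJ.eigenvalues m : ℂ))⁻¹ * (x - (hJ.eigenvalues m : ℂ))) = 1 := by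
            ext m; simp [hne m]
          rw [this]
          have h5 : Matrix.diagonal (1 : Fin (n + 1) × Fin r → ℂ) = 1 := Matrix.diagonal_one
          rw [h5, mul_one, hU']
    have h5 := congrArg (fun v => S *ᵥ v) h1
    simp only [h2, Matrix.mulVec_mulVec, h4, Matrix.one_mulVec, Matrix.mulVec_single_one] at h5
    exact congrFun h5 (k, i)

/-! ### Convergence of the moments -/

/-- The block `(l, n)` of the `k`-th power of the truncated Jacobi matrix. -/
def momentBlock (a b : ℕ → Matrix (Fin r) (Fin r) ℂ) (n k l : ℕ) : Matrix (Fin r) (Fin r) ℂ :=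
  Matrix.of fun i j =>
    if h : l < n + 1 then (jacobi a b n ^ k) (⟨l, h⟩, i) (Fin.last n, j) else 0

theorem momentBlock_succ (a b : ℕ → Matrix (Fin r) (Fin r) ℂ) (n k l : ℕ) (hl : l ≤ n) :
    momentBlock a b n (k + 1) l =
      (if l + 1 ≤ n then a (l + 1) * momentBlock a b n k (l + 1) else 0) +
        b l * momentBlock a b n k l +
        (if 1 ≤ l then (a l)ᴴ * momentBlock a b n k (l - 1) else 0) := by
  ext i j
  have h1 := jacobi_mulVec a b n (fun l i => momentBlock a b n k l i j) ⟨l, by omega⟩ i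
  have h2 : (fun p : Fin (n + 1) × Fin r => momentBlock a b n k p.1 p.2 j) =
      fun p => (jacobi a b n ^ k) p (Fin.last n, j) := by
    ext ⟨p, q⟩
    simp only [momentBlock, Matrix.of_apply, dif_pos p.2]
  have h3 : momentBlock a b n (k + 1) l i j =
      (jacobi a b n *ᵥ fun p => (jacobi a b n ^ k) p (Fin.last n, j)) (⟨l, by omega⟩, i) := by
    simp only [momentBlock, Matrix.of_apply, dif_pos (show l < n + 1 by omega), pow_succ']
    rfl
  rw [h3, ← h2, h1]
  simp only [Matrix.add_apply]
  congr 1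
  · congr 1
    split_ifs <;> rfl
  · split_ifs <;> rfl

/-- One more power of the Jacobi matrix mixes only neighbouring blocks, so induction on `k` works
once all offsets `m` from the last row are treated together. -/
theorem exists_tendsto_momentBlock {A B : ℕ → ℝ → Matrix (Fin r) (Fin r) ℂ}
    {As Bs : Matrix (Fin r) (Fin r) ℂ} {s : ℝ}
    (hA : Tendsto (fun p : ℕ × ℝ => A p.1 p.2) (localLim s) (𝓝 As))
    (hB : Tendsto (fun p : ℕ × ℝ => B p.1 p.2) (localLim s) (𝓝 Bs)) (k : ℕ) :
    ∀ m : ℕ, ∃ L, Tendsto (fun p : ℕ × ℝ =>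
      momentBlock (fun n => A n p.2) (fun n => B n p.2) p.1 k (p.1 - m)) (localLim s) (𝓝 L) := by
  have hAm : ∀ m : ℕ, Tendsto (fun p : ℕ × ℝ => A (p.1 - m) p.2) (localLim s) (𝓝 As) :=
    fun m => hA.comp (tendsto_localLim_sub s m)
  have hBm : ∀ m : ℕ, Tendsto (fun p : ℕ × ℝ => B (p.1 - m) p.2) (localLim s) (𝓝 Bs) :=
    fun m => hB.comp (tendsto_localLim_sub s m)
  induction k with
  | zero =>
    intro m
    refine ⟨if m = 0 then 1 else 0, tendsto_const_nhds.congr' ?_⟩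
    filter_upwards [(localLim_fst s).eventually_gt_atTop m] with p hp
    ext i j
    simp only [momentBlock, pow_zero, Matrix.of_apply, dif_pos (show p.1 - m < p.1 + 1 by omega),
      Matrix.one_apply, Prod.mk.injEq, Fin.ext_iff, Fin.val_last]
    by_cases hm : m = 0
    · simp [hm, Matrix.one_apply, Fin.ext_iff]
    · rw [if_neg hm, if_neg (by omega)]
      rfl
  | succ k ih =>
    intro m
    obtain ⟨L0, h0⟩ := ih m
    obtain ⟨L1, h1⟩ := ih (m + 1)
    have hup := ((hAm m).star).mul h1
    have hmid := (hBm m).mul h0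
    -- In the last block row, `m = 0`, there is no block below, so the term with the upper diagonal
    -- coefficient is absent.
    rcases m with _ | m
    · refine ⟨_, (hmid.add hup).congr' ?_⟩
      filter_upwards [(localLim_fst s).eventually_gt_atTop 1] with p hp
      rw [momentBlock_succ _ _ _ _ _ (by omega), if_neg (by omega), if_pos (by omega)]
      exact congrArg (· + _) (zero_add _).symm
    · obtain ⟨L2, h2⟩ := ih m
      have hdown := (hAm m).mul h2
      refine ⟨_, ((hdown.add hmid).add hup).congr' ?_⟩
      filter_upwards [(localLim_fst s).eventually_gt_atTop (m + 2)] with p hp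
      rw [momentBlock_succ _ _ _ _ _ (by omega), if_pos (by omega), if_pos (by omega),
        show p.1 - (m + 1) + 1 = p.1 - m by omega,
        show p.1 - (m + 1) - 1 = p.1 - (m + 1 + 1) by omega]
      rfl

/-! ### Convergence of the Green's function -/

section Limits

variable {A B : ℕ → ℝ → Matrix (Fin r) (Fin r) ℂ} {As Bs : Matrix (Fin r) (Fin r) ℂ} {s M : ℝ}

theorem eventually_zeros_sub (m : ℕ)
    (hzeros : ∀ᶠ p : ℕ × ℝ in localLim s, ∀ x : ℂ,
      (orthPoly (fun n => A n p.2) (fun n => B n p.2) p.1 x).det = 0 → x ∈ realInterval M) :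
    ∀ᶠ p : ℕ × ℝ in localLim s, ∀ x : ℂ,
      (orthPoly (fun n => A n p.2) (fun n => B n p.2) (p.1 - m) x).det = 0 → x ∈ realInterval M :=
  (tendsto_localLim_sub s m).eventually hzeros

theorem eventually_zeros_succ
    (hzeros : ∀ᶠ p : ℕ × ℝ in localLim s, ∀ x : ℂ,
      (orthPoly (fun n => A n p.2) (fun n => B n p.2) p.1 x).det = 0 → x ∈ realInterval M) :
    ∀ᶠ p : ℕ × ℝ in localLim s, ∀ x : ℂ,
      (orthPoly (fun n => A n p.2) (fun n => B n p.2) (p.1 + 1) x).det = 0 → x ∈ realInterval M :=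
  (tendsto_localLim_succ s).eventually hzeros

theorem eventually_spectral_representation
    (hA : ∀ n : ℕ, 1 ≤ n → ∀ N : ℝ, 0 < N → (A n N).det ≠ 0)
    (hB : ∀ n : ℕ, ∀ N : ℝ, 0 < N → (B n N).IsHermitian)
    (hzeros : ∀ᶠ p : ℕ × ℝ in localLim s, ∀ x : ℂ,
      (orthPoly (fun n => A n p.2) (fun n => B n p.2) p.1 x).det = 0 → x ∈ realInterval M) :
    ∀ᶠ p : ℕ × ℝ in localLim s,
    ∃ (U : Matrix (Fin (p.1 + 1) × Fin r) (Fin (p.1 + 1) × Fin r) ℂ)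
      (t : Fin (p.1 + 1) × Fin r → ℝ), Uᴴ * U = 1 ∧ U * Uᴴ = 1 ∧
      (∀ m, t m ∈ Set.Icc (-M) M) ∧
      (∀ k, jacobi (fun n => A n p.2) (fun n => B n p.2) p.1 ^ k =
        U * Matrix.diagonal (fun m => (t m : ℂ) ^ k) * Uᴴ) ∧
      ∀ x, x ∉ realInterval M → ∀ k i j,
        greenColumn (fun n => A n p.2) (fun n => B n p.2) p.1 x (k : Fin (p.1 + 1)) i j =
        (U * Matrix.diagonal (fun m => (x - t m)⁻¹) * Uᴴ) (k, i) (Fin.last p.1, j) := by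
  filter_upwards [eventually_zeros_succ hzeros, (localLim_snd s).eventually_gt_atTop 0]
    with p hp hN
  exact exists_spectral_representation (fun n hn => hA n hn _ hN) (fun n => hB n _ hN) p.1 hp

/-- The values form a Cauchy family: a polynomial uniformly close to `(x - t)⁻¹` on `[-M, M]`
replaces the resolvent entry by a finite combination of convergent moments, with an error
independent of `n` and `N`. -/
theorem exists_tendsto_green (hs : 0 < s)
    (hA : ∀ n : ℕ, 1 ≤ n → ∀ N : ℝ, 0 < N → (A n N).det ≠ 0)
    (hB : ∀ n : ℕ, ∀ N : ℝ, 0 < N → (B n N).IsHermitian)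
    (hAlim : Tendsto (fun p : ℕ × ℝ => A p.1 p.2) (localLim s) (𝓝 As))
    (hBlim : Tendsto (fun p : ℕ × ℝ => B p.1 p.2) (localLim s) (𝓝 Bs))
    (hzeros : ∀ᶠ p : ℕ × ℝ in localLim s, ∀ x : ℂ,
      (orthPoly (fun n => A n p.2) (fun n => B n p.2) p.1 x).det = 0 → x ∈ realInterval M)
    {x : ℂ} (hx : x ∉ realInterval M) (i j : Fin r) :
    ∃ w, Tendsto (fun p : ℕ × ℝ =>
      greenColumn (fun n => A n p.2) (fun n => B n p.2) p.1 x p.1 i j) (localLim s) (𝓝 w) := by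
  have := localLim_neBot hs
  rw [← cauchy_map_iff_exists_tendsto, Metric.cauchy_iff]
  refine ⟨inferInstance, fun ε hε => ?_⟩
  obtain ⟨q, hq⟩ := exists_polynomial_approx_inv hx (show 0 < ε / 5 by positivity)
  choose L hL using fun k => exists_tendsto_momentBlock hAlim hBlim k 0
  have hlim : Tendsto (fun p : ℕ × ℝ => ∑ k ∈ Finset.range (q.natDegree + 1), q.coeff k *
      momentBlock (fun n => A n p.2) (fun n => B n p.2) p.1 k (p.1 - 0) i j) (localLim s)
      (𝓝 (∑ k ∈ Finset.range (q.natDegree + 1), q.coeff k * L k i j)) := by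
    refine tendsto_finsetSum _ fun k _ => ?_
    exact (((hL k).apply_nhds i).apply_nhds j).const_mul _
  have hev : ∀ᶠ p : ℕ × ℝ in localLim s,
      dist (greenColumn (fun n => A n p.2) (fun n => B n p.2) p.1 x p.1 i j)
        (∑ k ∈ Finset.range (q.natDegree + 1), q.coeff k * L k i j) < ε / 2 := by
    filter_upwards [eventually_spectral_representation hA hB hzeros,
      Metric.tendsto_nhds.1 hlim (ε / 5) (by positivity)] with p ⟨U, t, hU, hU', ht, hJ, hG⟩ hp
    refine (dist_triangle _ _ _).trans_lt ((add_lt_add_of_le_of_lt ?_ hp).trans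
      (show ε / 5 + ε / 5 < ε / 2 by linarith))
    have h1 := hG x hx (Fin.last p.1) i j
    rw [Fin.val_last] at h1
    have h2 : ∑ k ∈ Finset.range (q.natDegree + 1), q.coeff k *
        momentBlock (fun n => A n p.2) (fun n => B n p.2) p.1 k (p.1 - 0) i j =
        (U * Matrix.diagonal (fun m => q.eval (t m : ℂ)) * Uᴴ) (Fin.last p.1, i)
          (Fin.last p.1, j) := by
      rw [unitary_conj_entry]
      simp only [Polynomial.eval_eq_sum_range, Finset.mul_sum, Finset.sum_mul]
      rw [Finset.sum_comm]
      refine Finset.sum_congr rfl fun k _ => ?_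
      simp only [momentBlock, Matrix.of_apply, Nat.sub_zero, dif_pos (Nat.lt_succ_self p.1), hJ]
      have h3 : (⟨p.1, Nat.lt_succ_self p.1⟩ : Fin (p.1 + 1)) = Fin.last p.1 := rfl
      rw [h3, unitary_conj_entry, Finset.mul_sum]
      refine Finset.sum_congr rfl fun m _ => ?_
      ring
    rw [h1, h2, dist_eq_norm, unitary_conj_entry, unitary_conj_entry, ← Finset.sum_sub_distrib]
    have h4 := unitary_conj_entry_le hU hU' (by positivity)
      (fun m => hq (t m) (ht m)) (Fin.last p.1, i) (Fin.last p.1, j)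
    rw [unitary_conj_entry] at h4
    refine le_trans (le_of_eq ?_) h4
    congr 1
    refine Finset.sum_congr rfl fun m _ => ?_
    ring
  refine ⟨_, image_mem_map hev, ?_⟩
  rintro _ ⟨p, hp, rfl⟩ _ ⟨p', hp', rfl⟩
  have h5 := dist_triangle_right (greenColumn (fun n => A n p.2) (fun n => B n p.2) p.1 x p.1 i j)
    (greenColumn (fun n => A n p'.2) (fun n => B n p'.2) p'.1 x p'.1 i j)
    (∑ k ∈ Finset.range (q.natDegree + 1), q.coeff k * L k i j)
  simp only [Set.mem_ofPred_eq] at hp hp'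
  linarith

/-- Convergence is joint in `(n, N)` and the spectral variable, which later yields uniformity on
compact sets. It follows from pointwise convergence because the resolvent entries are Lipschitz near
`x` with constant `d⁻²`, where `d` bounds the distance to `[-M, M]` from below. -/
theorem exists_green_limit (hs : 0 < s)
    (hA : ∀ n : ℕ, 1 ≤ n → ∀ N : ℝ, 0 < N → (A n N).det ≠ 0)
    (hB : ∀ n : ℕ, ∀ N : ℝ, 0 < N → (B n N).IsHermitian)
    (hAlim : Tendsto (fun p : ℕ × ℝ => A p.1 p.2) (localLim s) (𝓝 As))
    (hBlim : Tendsto (fun p : ℕ × ℝ => B p.1 p.2) (localLim s) (𝓝 Bs))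
    (hzeros : ∀ᶠ p : ℕ × ℝ in localLim s, ∀ x : ℂ,
      (orthPoly (fun n => A n p.2) (fun n => B n p.2) p.1 x).det = 0 → x ∈ realInterval M) :
    ∃ W : ℂ → Matrix (Fin r) (Fin r) ℂ, ∀ x, x ∉ realInterval M →
      Tendsto (fun q : (ℕ × ℝ) × ℂ =>
        greenColumn (fun n => A n q.1.2) (fun n => B n q.1.2) q.1.1 q.2 q.1.1)
        (localLim s ×ˢ 𝓝 x) (𝓝 (W x)) := by
  have hex : ∀ x, ∃ W : Matrix (Fin r) (Fin r) ℂ, x ∉ realInterval M → ∀ i j,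
      Tendsto (fun p : ℕ × ℝ =>
        greenColumn (fun n => A n p.2) (fun n => B n p.2) p.1 x p.1 i j) (localLim s)
        (𝓝 (W i j)) := by
    intro x
    by_cases hx : x ∈ realInterval M
    · exact ⟨0, fun h => absurd hx h⟩
    · choose w hw using exists_tendsto_green hs hA hB hAlim hBlim hzeros hx
      exact ⟨Matrix.of w, fun _ => hw⟩
  choose W hW using hex
  refine ⟨W, fun x hx => tendsto_pi_nhds.2 fun i => tendsto_pi_nhds.2 fun j => ?_⟩
  have h1 : Tendsto (fun q : (ℕ × ℝ) × ℂ =>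
      greenColumn (fun n => A n q.1.2) (fun n => B n q.1.2) q.1.1 x q.1.1 i j)
      (localLim s ×ˢ 𝓝 x) (𝓝 (W x i j)) := (hW x hx i j).comp tendsto_fst
  obtain ⟨d, hd, hball⟩ := exists_dist_realInterval hx
  have h2 : Tendsto (fun q : (ℕ × ℝ) × ℂ =>
      greenColumn (fun n => A n q.1.2) (fun n => B n q.1.2) q.1.1 q.2 q.1.1 i j -
      greenColumn (fun n => A n q.1.2) (fun n => B n q.1.2) q.1.1 x q.1.1 i j)
      (localLim s ×ˢ 𝓝 x) (𝓝 0) := by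
    have h3 : Tendsto (fun q : (ℕ × ℝ) × ℂ => ‖q.2 - x‖ / d ^ 2) (localLim s ×ˢ 𝓝 x) (𝓝 0) := by
      have h4 : Tendsto (fun y : ℂ => ‖y - x‖ / d ^ 2) (𝓝 x) (𝓝 (‖x - x‖ / d ^ 2)) :=
        (by fun_prop : Continuous fun y : ℂ => ‖y - x‖ / d ^ 2).tendsto x
      rw [sub_self, norm_zero, zero_div] at h4
      exact h4.comp tendsto_snd
    refine squeeze_zero_norm' ?_ h3
    filter_upwards [(eventually_spectral_representation hA hB hzeros).prod_mk
      (Metric.ball_mem_nhds x hd)] with ⟨p, y⟩ ⟨⟨U, t, hU, hU', ht, hJ, hG⟩, hy⟩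
    have hyI : y ∉ realInterval M := by
      rintro ⟨u, hu, rfl⟩
      have := hball _ hy u hu
      rw [sub_self, norm_zero] at this
      linarith
    have e1 := hG x hx (Fin.last p.1) i j
    have e2 := hG y hyI (Fin.last p.1) i j
    rw [Fin.val_last] at e1 e2
    simp only
    rw [e1, e2, unitary_conj_entry, unitary_conj_entry, ← Finset.sum_sub_distrib]
    have hg : ∀ m, ‖(y - (t m : ℂ))⁻¹ - (x - (t m : ℂ))⁻¹‖ ≤ ‖y - x‖ / d ^ 2 := by
      intro m
      have b1 := hball y hy (t m) (ht m)
      have b2 := hball x (Metric.mem_ball_self hd) (t m) (ht m)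
      have n1 : y - (t m : ℂ) ≠ 0 := norm_pos_iff.1 (hd.trans_le b1)
      have n2 : x - (t m : ℂ) ≠ 0 := norm_pos_iff.1 (hd.trans_le b2)
      rw [inv_sub_inv n1 n2, norm_div, norm_mul, sub_sub_sub_cancel_right, norm_sub_rev x y]
      gcongr
      nlinarith
    have h4 := unitary_conj_entry_le hU hU' (by positivity) hg (Fin.last p.1, i) (Fin.last p.1, j)
    rw [unitary_conj_entry] at h4
    refine le_trans (le_of_eq ?_) h4
    congr 1
    refine Finset.sum_congr rfl fun m _ => ?_
    ring
  have h5 := h2.add h1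
  simpa using h5

end Limits

/-! ### Properties of the limit of the ratio -/

section Properties

variable {A B : ℕ → ℝ → Matrix (Fin r) (Fin r) ℂ} {As Bs : Matrix (Fin r) (Fin r) ℂ} {s M : ℝ}
  {W : ℂ → Matrix (Fin r) (Fin r) ℂ}

theorem tendsto_apply_of_prod_nhds {α X Y : Type*} [TopologicalSpace X] {l : Filter α}
    {l' : Filter Y} {F : α → X → Y} {x : X}
    (h : Tendsto (fun q : α × X => F q.1 q.2) (l ×ˢ 𝓝 x) l') : Tendsto (fun p => F p x) l l' :=
  h.comp (tendsto_id.prodMk tendsto_const_nhds)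

theorem tendsto_green_apply {x : ℂ}
    (hW : Tendsto (fun q : (ℕ × ℝ) × ℂ =>
      greenColumn (fun n => A n q.1.2) (fun n => B n q.1.2) q.1.1 q.2 q.1.1)
      (localLim s ×ˢ 𝓝 x) (𝓝 (W x))) :
    Tendsto (fun p : ℕ × ℝ => greenColumn (fun n => A n p.2) (fun n => B n p.2) p.1 x p.1)
      (localLim s) (𝓝 (W x)) :=
  tendsto_apply_of_prod_nhds (F := fun (p : ℕ × ℝ) y =>
    greenColumn (fun n => A n p.2) (fun n => B n p.2) p.1 y p.1) hW

theorem tendsto_ratio_joint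
    (hA : ∀ n : ℕ, 1 ≤ n → ∀ N : ℝ, 0 < N → (A n N).det ≠ 0)
    (hAlim : Tendsto (fun p : ℕ × ℝ => A p.1 p.2) (localLim s) (𝓝 As)) {x : ℂ}
    (hW : Tendsto (fun q : (ℕ × ℝ) × ℂ =>
      greenColumn (fun n => A n q.1.2) (fun n => B n q.1.2) q.1.1 q.2 q.1.1)
      (localLim s ×ˢ 𝓝 x) (𝓝 (W x))) :
    Tendsto (fun q : (ℕ × ℝ) × ℂ =>
      orthPoly (fun n => A n q.1.2) (fun n => B n q.1.2) q.1.1 q.2 *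
        (orthPoly (fun n => A n q.1.2) (fun n => B n q.1.2) (q.1.1 + 1) q.2)⁻¹)
      (localLim s ×ˢ 𝓝 x) (𝓝 (W x * As)) := by
  have h1 : Tendsto (fun q : (ℕ × ℝ) × ℂ => A (q.1.1 + 1) q.1.2) (localLim s ×ˢ 𝓝 x) (𝓝 As) :=
    (hAlim.comp (tendsto_localLim_succ s)).comp tendsto_fst
  refine (hW.mul h1).congr' ?_
  have h2 : ∀ᶠ q : (ℕ × ℝ) × ℂ in localLim s ×ˢ 𝓝 x, 0 < q.1.2 :=
    tendsto_fst.eventually ((localLim_snd s).eventually_gt_atTop 0)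
  filter_upwards [h2] with q hq
  rw [greenColumn, Matrix.nonsing_inv_mul_cancel_right]
  exact isUnit_iff_ne_zero.2 (hA _ (by omega) _ hq)

theorem tendsto_ratio
    (hA : ∀ n : ℕ, 1 ≤ n → ∀ N : ℝ, 0 < N → (A n N).det ≠ 0)
    (hAlim : Tendsto (fun p : ℕ × ℝ => A p.1 p.2) (localLim s) (𝓝 As)) {x : ℂ}
    (hW : Tendsto (fun q : (ℕ × ℝ) × ℂ =>
      greenColumn (fun n => A n q.1.2) (fun n => B n q.1.2) q.1.1 q.2 q.1.1)
      (localLim s ×ˢ 𝓝 x) (𝓝 (W x))) :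
    Tendsto (fun p : ℕ × ℝ =>
      orthPoly (fun n => A n p.2) (fun n => B n p.2) p.1 x *
        (orthPoly (fun n => A n p.2) (fun n => B n p.2) (p.1 + 1) x)⁻¹)
      (localLim s) (𝓝 (W x * As)) :=
  tendsto_apply_of_prod_nhds (F := fun (p : ℕ × ℝ) y =>
    orthPoly (fun n => A n p.2) (fun n => B n p.2) p.1 y *
      (orthPoly (fun n => A n p.2) (fun n => B n p.2) (p.1 + 1) y)⁻¹)
    (tendsto_ratio_joint hA hAlim hW)

/-- The eigenvalues of the truncated matrix are real, so the adjoint of its resolvent at `x` is its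
resolvent at `x̄`. -/
theorem green_limit_star (hs : 0 < s)
    (hA : ∀ n : ℕ, 1 ≤ n → ∀ N : ℝ, 0 < N → (A n N).det ≠ 0)
    (hB : ∀ n : ℕ, ∀ N : ℝ, 0 < N → (B n N).IsHermitian)
    (hzeros : ∀ᶠ p : ℕ × ℝ in localLim s, ∀ x : ℂ,
      (orthPoly (fun n => A n p.2) (fun n => B n p.2) p.1 x).det = 0 → x ∈ realInterval M)
    (hW : ∀ x, x ∉ realInterval M → Tendsto (fun q : (ℕ × ℝ) × ℂ =>
      greenColumn (fun n => A n q.1.2) (fun n => B n q.1.2) q.1.1 q.2 q.1.1)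
      (localLim s ×ˢ 𝓝 x) (𝓝 (W x))) {x : ℂ} (hx : x ∉ realInterval M) :
    W (star x) = (W x)ᴴ := by
  have := localLim_neBot hs
  have hx' : star x ∉ realInterval M := fun h => hx (conj_mem_realInterval.1 h)
  have h1 := tendsto_green_apply (hW x hx)
  have h2 := tendsto_green_apply (hW _ hx')
  refine tendsto_nhds_unique h2 (h1.star.congr' ?_)
  filter_upwards [eventually_spectral_representation hA hB hzeros]
    with p ⟨U, t, hU, hU', ht, hJ, hG⟩
  ext i j
  have e1 := hG x hx (Fin.last p.1) j i
  have e2 := hG _ hx' (Fin.last p.1) i j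
  rw [Fin.val_last] at e1 e2
  rw [e2, Matrix.star_apply, e1, unitary_conj_entry, unitary_conj_entry, star_sum]
  refine Finset.sum_congr rfl fun m _ => ?_
  simp only [Complex.star_def, map_mul, map_inv₀, map_sub, Complex.conj_conj, Complex.conj_ofReal]
  ring

theorem ratio_limit_quadratic (hs : 0 < s)
    (hA : ∀ n : ℕ, 1 ≤ n → ∀ N : ℝ, 0 < N → (A n N).det ≠ 0)
    (hAlim : Tendsto (fun p : ℕ × ℝ => A p.1 p.2) (localLim s) (𝓝 As))
    (hBlim : Tendsto (fun p : ℕ × ℝ => B p.1 p.2) (localLim s) (𝓝 Bs))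
    (hzeros : ∀ᶠ p : ℕ × ℝ in localLim s, ∀ x : ℂ,
      (orthPoly (fun n => A n p.2) (fun n => B n p.2) p.1 x).det = 0 → x ∈ realInterval M)
    (hW : ∀ x, x ∉ realInterval M → Tendsto (fun q : (ℕ × ℝ) × ℂ =>
      greenColumn (fun n => A n q.1.2) (fun n => B n q.1.2) q.1.1 q.2 q.1.1)
      (localLim s ×ˢ 𝓝 x) (𝓝 (W x))) {x : ℂ} (hx : x ∉ realInterval M) :
    x • (W x * As) = As + Bs * (W x * As) + Asᴴ * ((W x * As) * (W x * As)) := by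
  have := localLim_neBot hs
  have hR := tendsto_ratio hA hAlim (hW x hx)
  -- The ratio `P_{n-1} P_n⁻¹` has the same limit, so `P_{n-1} P_{n+1}⁻¹` tends to `R²`.
  have hR1 := hR.comp (tendsto_localLim_sub s 1)
  have hA1 := hAlim.comp (tendsto_localLim_succ s)
  refine tendsto_nhds_unique (hR.const_smul x)
    (((hA1.add (hBlim.mul hR)).add (hAlim.star.mul (hR1.mul hR))).congr' ?_)
  filter_upwards [hzeros, eventually_zeros_succ hzeros, (localLim_snd s).eventually_gt_atTop 0,
    (localLim_fst s).eventually_gt_atTop 0] with p h1 h2 hN hn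
  obtain ⟨n, N⟩ := p
  obtain ⟨n, rfl⟩ : ∃ m, n = m + 1 := ⟨n - 1, by simp only at hn; omega⟩
  simp only at h1 h2 hN
  have hrec := orthPoly_recurrence_succ (fun n => A n N) (fun n => B n N)
    (fun n hn => hA n hn N hN) n x
  have hu1 : IsUnit (orthPoly (fun n => A n N) (fun n => B n N) (n + 1) x).det :=
    isUnit_iff_ne_zero.2 fun h => hx (h1 x h)
  have hu2 : IsUnit (orthPoly (fun n => A n N) (fun n => B n N) (n + 2) x).det :=
    isUnit_iff_ne_zero.2 fun h => hx (h2 x h)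
  simp only [Function.comp, Nat.add_sub_cancel, ← smul_mul_assoc]
  rw [hrec, add_mul, add_mul, Matrix.mul_nonsing_inv_cancel_right _ _ hu2,
    mul_assoc (orthPoly (fun n => A n N) (fun n => B n N) n x),
    Matrix.nonsing_inv_mul_cancel_left _ _ hu1]
  simp only [mul_assoc]
  rfl

/-- Telescoping: `P_{n-m} P_{n+1}⁻¹` is a product of `m + 1` consecutive ratios with a common limit.
-/
theorem tendsto_ratio_pow
    (hA : ∀ n : ℕ, 1 ≤ n → ∀ N : ℝ, 0 < N → (A n N).det ≠ 0)
    (hAlim : Tendsto (fun p : ℕ × ℝ => A p.1 p.2) (localLim s) (𝓝 As))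
    (hzeros : ∀ᶠ p : ℕ × ℝ in localLim s, ∀ x : ℂ,
      (orthPoly (fun n => A n p.2) (fun n => B n p.2) p.1 x).det = 0 → x ∈ realInterval M)
    {x : ℂ} (hx : x ∉ realInterval M)
    (hW : Tendsto (fun q : (ℕ × ℝ) × ℂ =>
      greenColumn (fun n => A n q.1.2) (fun n => B n q.1.2) q.1.1 q.2 q.1.1)
      (localLim s ×ˢ 𝓝 x) (𝓝 (W x))) (m : ℕ) :
    Tendsto (fun p : ℕ × ℝ =>
      orthPoly (fun n => A n p.2) (fun n => B n p.2) (p.1 - m) x *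
        (orthPoly (fun n => A n p.2) (fun n => B n p.2) (p.1 + 1) x)⁻¹)
      (localLim s) (𝓝 ((W x * As) ^ (m + 1))) := by
  have hR := tendsto_ratio hA hAlim hW
  induction m with
  | zero => simpa using hR
  | succ m ih =>
    rw [pow_succ']
    refine ((hR.comp (tendsto_localLim_sub s (m + 1))).mul ih).congr' ?_
    filter_upwards [eventually_zeros_sub m hzeros,
      (localLim_fst s).eventually_gt_atTop (m + 1)] with p h1 hn
    have hu : IsUnit (orthPoly (fun n => A n p.2) (fun n => B n p.2) (p.1 - m) x).det :=
      isUnit_iff_ne_zero.2 fun h => hx (h1 x h)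
    simp only [Function.comp]
    rw [show p.1 - (m + 1) + 1 = p.1 - m by omega, mul_assoc,
      Matrix.nonsing_inv_mul_cancel_left _ _ hu]

/-- The bound `c` does not depend on `m`: the sum is part of the squared norm of a resolvent column,
at most `d⁻²`. -/
theorem sum_green_sub_le
    (hA : ∀ n : ℕ, 1 ≤ n → ∀ N : ℝ, 0 < N → (A n N).det ≠ 0)
    (hB : ∀ n : ℕ, ∀ N : ℝ, 0 < N → (B n N).IsHermitian)
    (hzeros : ∀ᶠ p : ℕ × ℝ in localLim s, ∀ x : ℂ,
      (orthPoly (fun n => A n p.2) (fun n => B n p.2) p.1 x).det = 0 → x ∈ realInterval M)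
    {x : ℂ} (hx : x ∉ realInterval M) :
    ∃ c : ℝ, ∀ m : ℕ, ∀ᶠ p : ℕ × ℝ in localLim s, ∀ j,
      ∑ k ∈ Finset.range m, ∑ i,
        ‖greenColumn (fun n => A n p.2) (fun n => B n p.2) p.1 x (p.1 - k) i j‖ ^ 2 ≤ c := by
  obtain ⟨d, hd, hball⟩ := exists_dist_realInterval hx
  refine ⟨(d⁻¹) ^ 2, fun m => ?_⟩
  filter_upwards [eventually_spectral_representation hA hB hzeros,
    (localLim_fst s).eventually_gt_atTop m] with p ⟨U, t, hU, hU', ht, hJ, hG⟩ hm j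
  have hg : ∀ m, ‖(x - (t m : ℂ))⁻¹‖ ≤ d⁻¹ := fun m => by
    rw [norm_inv]
    exact inv_anti₀ hd (hball x (Metric.mem_ball_self hd) (t m) (ht m))
  refine le_trans ?_ (unitary_conj_column_le hU hU' hg (Fin.last p.1, j))
  rw [Fintype.sum_prod_type]
  simp only [← hG x hx]
  rw [Fin.sum_univ_eq_sum_range (fun l => ∑ i,
    ‖greenColumn (fun n => A n p.2) (fun n => B n p.2) p.1 x l i j‖ ^ 2) (p.1 + 1),
    ← Finset.sum_range_reflect (fun l => ∑ i,
    ‖greenColumn (fun n => A n p.2) (fun n => B n p.2) p.1 x l i j‖ ^ 2) (p.1 + 1)]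
  exact Finset.sum_le_sum_of_subset_of_nonneg (Finset.range_mono (by omega))
    fun _ _ _ => Finset.sum_nonneg fun _ _ => by positivity

/-- In the limit the column bound makes the entries of `R^{k+1} A⁻¹` square summable in `k`, so they
tend to zero. -/
theorem ratio_limit_pow_tendsto_zero (hs : 0 < s)
    (hA : ∀ n : ℕ, 1 ≤ n → ∀ N : ℝ, 0 < N → (A n N).det ≠ 0)
    (hB : ∀ n : ℕ, ∀ N : ℝ, 0 < N → (B n N).IsHermitian)
    (hAlim : Tendsto (fun p : ℕ × ℝ => A p.1 p.2) (localLim s) (𝓝 As))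
    (hAs : As.det ≠ 0)
    (hzeros : ∀ᶠ p : ℕ × ℝ in localLim s, ∀ x : ℂ,
      (orthPoly (fun n => A n p.2) (fun n => B n p.2) p.1 x).det = 0 → x ∈ realInterval M)
    {x : ℂ} (hx : x ∉ realInterval M)
    (hW : Tendsto (fun q : (ℕ × ℝ) × ℂ =>
      greenColumn (fun n => A n q.1.2) (fun n => B n q.1.2) q.1.1 q.2 q.1.1)
      (localLim s ×ˢ 𝓝 x) (𝓝 (W x))) :
    Tendsto (fun m : ℕ => (W x * As) ^ m) atTop (𝓝 0) := by
  have := localLim_neBot hs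
  obtain ⟨c, hc⟩ := sum_green_sub_le hA hB hzeros hx
  have hinv : Tendsto (fun p : ℕ × ℝ => (A (p.1 + 1) p.2)⁻¹) (localLim s) (𝓝 As⁻¹) := by
    have hA1 := hAlim.comp (tendsto_localLim_succ s)
    simp only [Matrix.inv_def, Ring.inverse_eq_inv']
    exact (((continuous_id.matrix_det.tendsto As).comp hA1).inv₀ hAs).smul
      ((continuous_id.matrix_adjugate.tendsto As).comp hA1)
  have hlim : ∀ k, Tendsto (fun p : ℕ × ℝ =>
      greenColumn (fun n => A n p.2) (fun n => B n p.2) p.1 x (p.1 - k)) (localLim s)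
      (𝓝 ((W x * As) ^ (k + 1) * As⁻¹)) :=
    fun k => (tendsto_ratio_pow hA hAlim hzeros hx hW k).mul hinv
  have hent : ∀ i j, Tendsto (fun k => ((W x * As) ^ (k + 1) * As⁻¹) i j) atTop (𝓝 0) := by
    intro i j
    have hsum : ∀ m, ∑ k ∈ Finset.range m, ‖((W x * As) ^ (k + 1) * As⁻¹) i j‖ ^ 2 ≤ c := by
      intro m
      refine le_of_tendsto (tendsto_finsetSum _ fun k _ =>
        ((((hlim k).apply_nhds i).apply_nhds j).norm.pow 2)) ?_
      filter_upwards [hc m] with p hp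
      refine le_trans (Finset.sum_le_sum fun k _ => ?_) (hp j)
      exact Finset.single_le_sum (f := fun i =>
        ‖greenColumn (fun n => A n p.2) (fun n => B n p.2) p.1 x (p.1 - k) i j‖ ^ 2)
        (fun _ _ => by positivity) (Finset.mem_univ i)
    have h1 := (summable_of_sum_range_le (fun _ => by positivity) hsum).tendsto_atTop_zero
    rw [tendsto_zero_iff_norm_tendsto_zero]
    have h2 := h1.sqrt
    simpa using h2
  have hmat : Tendsto (fun k => (W x * As) ^ (k + 1) * As⁻¹) atTop (𝓝 0) :=
    tendsto_pi_nhds.2 fun i => tendsto_pi_nhds.2 fun j => hent i j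
  rw [← tendsto_add_atTop_iff_nat 1]
  have h3 := hmat.mul_const As
  rw [zero_mul] at h3
  refine h3.congr fun k => ?_
  rw [Matrix.nonsing_inv_mul_cancel_right _ _ (isUnit_iff_ne_zero.2 hAs)]

end Properties

/-! ### The solvent of the quadratic matrix equation -/

theorem norm_lt_one_of_pow_tendsto_zero {T : Matrix (Fin r) (Fin r) ℂ}
    (hT : Tendsto (fun m : ℕ => T ^ m) atTop (𝓝 0)) {z : ℂ} {v : Fin r → ℂ} (hv : v ≠ 0)
    (h : T *ᵥ v = z • v) : ‖z‖ < 1 := by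
  obtain ⟨i, hi⟩ := Function.ne_iff.1 hv
  have hpow : ∀ m : ℕ, T ^ m *ᵥ v = z ^ m • v := by
    intro m
    induction m with
    | zero => simp
    | succ m ih =>
      rw [pow_succ, ← Matrix.mulVec_mulVec, h, Matrix.mulVec_smul, ih, smul_smul, pow_succ']
  have h1 : Tendsto (fun m : ℕ => (T ^ m *ᵥ v) i) atTop (𝓝 0) := by
    have h2 : Continuous fun S : Matrix (Fin r) (Fin r) ℂ => (S *ᵥ v) i :=
      (continuous_apply i).comp (continuous_id.matrix_mulVec continuous_const)
    have h3 := (h2.tendsto 0).comp hT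
    rw [Matrix.zero_mulVec] at h3
    exact h3
  rw [← tendsto_pow_atTop_nhds_zero_iff_norm_lt_one]
  have h4 := h1.mul_const (v i)⁻¹
  rw [zero_mul] at h4
  refine h4.congr fun m => ?_
  rw [hpow, Pi.smul_apply, smul_eq_mul, mul_assoc, mul_inv_cancel₀ hi, mul_one]

/-- The linear factor that remains after a right division of `Z² A^* + Z (B - x) + A` by
`Z - R`. -/
def leftFactor (A B R : Matrix (Fin r) (Fin r) ℂ) (x : ℂ) :
    Matrix (Fin r) (Fin r) (Polynomial ℂ) :=
  (Polynomial.X : Polynomial ℂ) • (Aᴴ).map Polynomial.C +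
    (Aᴴ * R + B - x • (1 : Matrix (Fin r) (Fin r) ℂ)).map Polynomial.C

theorem symbolPoly_eq_mul {A B R : Matrix (Fin r) (Fin r) ℂ} {x : ℂ}
    (hR : x • R = A + B * R + Aᴴ * (R * R)) :
    symbolPoly A B x = (leftFactor A B R x).det * R.charpoly := by
  rw [Matrix.charpoly, ← Matrix.det_mul, symbolPoly]
  congr 1
  have hA : A = x • R - B * R - Aᴴ * R * R := by rw [hR, mul_assoc]; abel
  have hA' : A.map Polynomial.C = -((Aᴴ * R + B - x • (1 : Matrix (Fin r) (Fin r) ℂ)).map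
      Polynomial.C * R.map Polynomial.C) := by
    rw [← Matrix.map_mul]
    conv_lhs => rw [hA]
    rw [← Matrix.map_neg _ (fun a => by simp)]
    congr 1
    rw [sub_mul, add_mul, smul_mul_assoc, one_mul]
    abel
  have hmap : (Aᴴ * R + B - x • (1 : Matrix (Fin r) (Fin r) ℂ)).map Polynomial.C =
      (Aᴴ).map Polynomial.C * R.map Polynomial.C +
      (B - x • (1 : Matrix (Fin r) (Fin r) ℂ)).map Polynomial.C := by
    rw [← Matrix.map_mul, ← Matrix.map_add _ (fun a b => by simp), add_sub_assoc]
  have hchar : R.charmatrix = (Polynomial.X : Polynomial ℂ) • 1 - R.map Polynomial.C := by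
    rw [Matrix.charmatrix, Matrix.smul_one_eq_diagonal]
    rfl
  rw [leftFactor, hchar, add_mul, mul_sub, mul_sub, ← sub_eq_zero, hA', hmap]
  simp only [smul_mul_assoc, mul_smul_comm, mul_one, smul_add, smul_smul, pow_two]
  abel

theorem leftFactor_eval (A B R : Matrix (Fin r) (Fin r) ℂ) (x z : ℂ) :
    (leftFactor A B R x).det.eval z =
      (z • Aᴴ + (Aᴴ * R + B - x • (1 : Matrix (Fin r) (Fin r) ℂ))).det := by
  rw [← Polynomial.coe_evalRingHom, RingHom.map_det]
  congr 1
  ext i j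
  simp only [leftFactor, RingHom.mapMatrix_apply, Matrix.map_apply, Matrix.add_apply,
    Matrix.smul_apply, smul_eq_mul, Polynomial.coe_evalRingHom, Polynomial.eval_add,
    Polynomial.eval_mul, Polynomial.eval_X, Polynomial.eval_C]

/-- A left null vector `v` of the left factor satisfies `z v A^* W = v`. Taking adjoints, `v^*` is
an eigenvector of `W^* A` with eigenvalue the conjugate of `z⁻¹`. In the application `W^* A` is the
ratio limit at `x̄`, so its powers also tend to zero. -/
theorem one_lt_norm_of_leftFactor_root {A B R W : Matrix (Fin r) (Fin r) ℂ} {x : ℂ}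
    (hA : A.det ≠ 0) (hR : x • R = A + B * R + Aᴴ * (R * R)) (hRW : R = W * A)
    (hT : Tendsto (fun m : ℕ => (Wᴴ * A) ^ m) atTop (𝓝 0)) {z : ℂ}
    (hz : (z • Aᴴ + (Aᴴ * R + B - x • (1 : Matrix (Fin r) (Fin r) ℂ))).det = 0) : 1 < ‖z‖ := by
  have hu : IsUnit A.det := isUnit_iff_ne_zero.2 hA
  -- The quadratic equation reads `(A^* R + B - x) R = -A`; put `R = W A` and cancel `A`.
  have hW : (Aᴴ * R + B - x • (1 : Matrix (Fin r) (Fin r) ℂ)) * W = -1 := by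
    have h1 : (Aᴴ * R + B - x • (1 : Matrix (Fin r) (Fin r) ℂ)) * W * A = -1 * A := by
      rw [mul_assoc, ← hRW, sub_mul, add_mul, smul_mul_assoc, one_mul, hR, mul_assoc, neg_one_mul]
      abel
    have h2 := congrArg (· * A⁻¹) h1
    simpa [Matrix.mul_nonsing_inv_cancel_right _ _ hu, Matrix.mul_nonsing_inv _ hu] using h2
  obtain ⟨v, hv, hv0⟩ := Matrix.exists_vecMul_eq_zero_iff.2 hz
  have h1 : z • (v ᵥ* (Aᴴ * W)) = v := by
    have h2 := congrArg (fun w => w ᵥ* W) hv0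
    simp only [Matrix.vecMul_vecMul, Matrix.zero_vecMul] at h2
    rw [add_mul, hW, Matrix.vecMul_add, Matrix.vecMul_neg, Matrix.vecMul_one, smul_mul_assoc,
      Matrix.vecMul_smul, ← sub_eq_add_neg, sub_eq_zero] at h2
    exact h2
  have hz0 : z ≠ 0 := by
    rintro rfl
    rw [zero_smul] at h1
    exact hv h1.symm
  have h3 : (Wᴴ * A) *ᵥ star v = star z⁻¹ • star v := by
    have h4 : v ᵥ* (Aᴴ * W) = z⁻¹ • v := by
      conv_rhs => rw [← h1]
      rw [smul_smul, inv_mul_cancel₀ hz0, one_smul]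
    have h5 := congrArg star h4
    rw [Matrix.star_vecMul, Matrix.conjTranspose_mul, Matrix.conjTranspose_conjTranspose,
      star_smul] at h5
    exact h5
  have h6 := norm_lt_one_of_pow_tendsto_zero hT (by simpa using hv) h3
  rw [norm_star, norm_inv] at h6
  exact (inv_lt_one₀ (norm_pos_iff.2 hz0)).1 h6

theorem symbolPoly_eval_zero (A B : Matrix (Fin r) (Fin r) ℂ) (x : ℂ) :
    (symbolPoly A B x).eval 0 = A.det := by
  rw [symbolPoly, ← Polynomial.coe_evalRingHom, RingHom.map_det]
  congr 1
  ext i j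
  simp

theorem symbolPoly_ne_zero {A : Matrix (Fin r) (Fin r) ℂ} (hA : A.det ≠ 0)
    (B : Matrix (Fin r) (Fin r) ℂ) (x : ℂ) : symbolPoly A B x ≠ 0 := fun h => hA <| by
  rw [← symbolPoly_eval_zero A B x, h, Polynomial.eval_zero]

/-- The factorization at the level of matrices, needed to follow null vectors and not only
determinants. -/
theorem smul_pencil {A B R : Matrix (Fin r) (Fin r) ℂ} {x : ℂ}
    (hR : x • R = A + B * R + Aᴴ * (R * R)) {z : ℂ} (hz : z ≠ 0) :
    z • pencil A B z x = (z • Aᴴ + (Aᴴ * R + B - x • (1 : Matrix (Fin r) (Fin r) ℂ))) *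
      (z • (1 : Matrix (Fin r) (Fin r) ℂ) - R) := by
  have hA : A = x • R - B * R - Aᴴ * R * R := by rw [hR, mul_assoc]; abel
  have h1 : z • pencil A B z x = (z * z) • Aᴴ + z • B + A -
      (z * x) • (1 : Matrix (Fin r) (Fin r) ℂ) := by
    simp only [pencil, smul_add, smul_sub, smul_smul, mul_inv_cancel₀ hz, one_smul]
  rw [h1]
  simp only [add_mul, sub_mul, mul_sub, smul_mul_assoc, mul_smul_comm, mul_one, one_mul, smul_smul,
    smul_add, smul_sub]
  nth_rewrite 2 [hA]
  abel

/-! ### Ordered root lists -/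

theorem smallIdx_injective : Function.Injective (smallIdx : Fin r → Fin (2 * r)) :=
  fun _ _ h => Fin.castLE_injective (by omega) h

theorem map_smallIdx_eq {z : Fin (2 * r) → ℂ} (hz : Monotone fun k => ‖z k‖) {S T : Multiset ℂ}
    (hST : (Finset.univ : Finset (Fin (2 * r))).val.map z = S + T) (hcard : S.card = r)
    (hS : ∀ w ∈ S, ‖w‖ < 1) (hT : ∀ w ∈ T, ¬ ‖w‖ < 1) :
    (Finset.univ : Finset (Fin r)).val.map (fun k => z (smallIdx k)) = S := by
  classical
  have h1 := congrArg (Multiset.filter fun w : ℂ => ‖w‖ < 1) hST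
  rw [Multiset.filter_add, Multiset.filter_eq_self.2 hS, Multiset.filter_eq_nil.2 hT, add_zero,
    Multiset.filter_map] at h1
  set F : Finset (Fin (2 * r)) := Finset.univ.filter fun k => ‖z k‖ < 1 with hF
  have h2 : F.val.map z = S := h1
  have hFc : F.card = r := by
    refine Eq.trans ?_ hcard
    rw [← h2, Multiset.card_map]
    rfl
  have hsub : F ⊆ Finset.univ.map ⟨smallIdx, smallIdx_injective⟩ := by
    intro k hk
    -- By monotonicity the indices of roots inside the disc form an initial segment. It has `r`
    -- elements, so it is the range of `smallIdx` however ties are broken.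
    have h3 : Finset.Iic k ⊆ F := fun j hj => by
      rw [hF, Finset.mem_filter] at hk ⊢
      exact ⟨Finset.mem_univ _, (hz (Finset.mem_Iic.1 hj)).trans_lt hk.2⟩
    have h4 := Finset.card_le_card h3
    rw [Fin.card_Iic, hFc] at h4
    exact Finset.mem_map.2 ⟨⟨k, by omega⟩, Finset.mem_univ _, rfl⟩
  have hFeq := Finset.eq_of_subset_of_card_le hsub (by simp [hFc])
  rw [← h2, hFeq, Finset.map_val, Multiset.map_map]
  rfl

/-- The `r` smallest roots are the eigenvalues of the solvent. -/
theorem map_smallIdx_eq_roots_charpoly {A B R W : Matrix (Fin r) (Fin r) ℂ} {x : ℂ}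
    (hA : A.det ≠ 0) (hR : x • R = A + B * R + Aᴴ * (R * R)) (hRW : R = W * A)
    (hRpow : Tendsto (fun m : ℕ => R ^ m) atTop (𝓝 0))
    (hT : Tendsto (fun m : ℕ => (Wᴴ * A) ^ m) atTop (𝓝 0)) {z : Fin (2 * r) → ℂ}
    (hz : IsRootLabelling A B x z) :
    (Finset.univ : Finset (Fin r)).val.map (fun k => z (smallIdx k)) = R.charpoly.roots := by
  have hne := symbolPoly_ne_zero hA B x
  rw [symbolPoly_eq_mul hR] at hne
  refine map_smallIdx_eq hz.monotone_norm (T := (leftFactor A B R x).det.roots) ?_ ?_ ?_ ?_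
  · rw [hz.roots_eq, symbolPoly_eq_mul hR, Polynomial.roots_mul hne, add_comm]
  · rw [← (IsAlgClosed.splits R.charpoly).natDegree_eq_card_roots, Matrix.charpoly_natDegree_eq_dim,
      Fintype.card_fin]
  · intro w hw
    have h1 := (Polynomial.mem_roots'.1 hw).2
    rw [Polynomial.IsRoot, Matrix.eval_charpoly] at h1
    obtain ⟨v, hv, hv0⟩ := Matrix.exists_mulVec_eq_zero_iff.2 h1
    refine norm_lt_one_of_pow_tendsto_zero hRpow hv (z := w) ?_
    rw [Matrix.sub_mulVec, sub_eq_zero] at hv0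
    rw [← hv0]
    ext i
    simp
  · intro w hw
    have h1 := (Polynomial.mem_roots'.1 hw).2
    rw [Polynomial.IsRoot, leftFactor_eval] at h1
    exact not_lt.2 (one_lt_norm_of_leftFactor_root hA hR hRW hT h1).le

theorem det_eq_prod_smallIdx {A B R W : Matrix (Fin r) (Fin r) ℂ} {x : ℂ}
    (hA : A.det ≠ 0) (hR : x • R = A + B * R + Aᴴ * (R * R)) (hRW : R = W * A)
    (hRpow : Tendsto (fun m : ℕ => R ^ m) atTop (𝓝 0))
    (hT : Tendsto (fun m : ℕ => (Wᴴ * A) ^ m) atTop (𝓝 0)) {z : Fin (2 * r) → ℂ}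
    (hz : IsRootLabelling A B x z) : R.det = ∏ k : Fin r, z (smallIdx k) := by
  rw [Matrix.det_eq_prod_roots_charpoly, ← map_smallIdx_eq_roots_charpoly hA hR hRW hRpow hT hz]
  rfl

/-- At a root inside the unit disc the left factor is invertible, so a null vector of the pencil is
killed by `z - R`. -/
theorem mulVec_eq_smul_of_isEigenSystem {A B R W : Matrix (Fin r) (Fin r) ℂ} {x : ℂ}
    (hA : A.det ≠ 0) (hR : x • R = A + B * R + Aᴴ * (R * R)) (hRW : R = W * A)
    (hRpow : Tendsto (fun m : ℕ => R ^ m) atTop (𝓝 0))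
    (hT : Tendsto (fun m : ℕ => (Wᴴ * A) ^ m) atTop (𝓝 0)) {z : Fin (2 * r) → ℂ}
    {v : Fin (2 * r) → Fin r → ℂ} (hzv : IsEigenSystem A B x z v) (k : Fin r) :
    R *ᵥ v (smallIdx k) = z (smallIdx k) • v (smallIdx k) := by
  have hroot : ∀ l, (symbolPoly A B x).eval (z l) = 0 := fun l => by
    have h1 : z l ∈ (symbolPoly A B x).roots := by
      rw [← hzv.labelling.roots_eq]
      exact Multiset.mem_map_of_mem z (Finset.mem_univ l)
    exact (Polynomial.mem_roots'.1 h1).2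
  have hz0 : ∀ l, z l ≠ 0 := fun l h => by
    have h1 := hroot l
    rw [h, symbolPoly_eval_zero] at h1
    exact hA h1
  have hsmall : ‖z (smallIdx k)‖ < 1 := by
    have h1 : z (smallIdx k) ∈ R.charpoly.roots := by
      rw [← map_smallIdx_eq_roots_charpoly hA hR hRW hRpow hT hzv.labelling]
      exact Multiset.mem_map_of_mem (fun k => z (smallIdx k)) (Finset.mem_univ k)
    have h2 := (Polynomial.mem_roots'.1 h1).2
    rw [Polynomial.IsRoot, Matrix.eval_charpoly] at h2
    obtain ⟨u, hu, hu0⟩ := Matrix.exists_mulVec_eq_zero_iff.2 h2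
    refine norm_lt_one_of_pow_tendsto_zero hRpow hu ?_
    rw [Matrix.sub_mulVec, sub_eq_zero] at hu0
    rw [← hu0]
    ext i
    simp
  have h1 := congrArg (fun w => z (smallIdx k) • w) (hzv.null_vector (smallIdx k))
  simp only [smul_zero] at h1
  rw [← Matrix.smul_mulVec, smul_pencil hR (hz0 _), ← Matrix.mulVec_mulVec] at h1
  have h2 : (z (smallIdx k) • (1 : Matrix (Fin r) (Fin r) ℂ) - R) *ᵥ v (smallIdx k) = 0 := by
    by_contra hne
    have h3 := Matrix.exists_mulVec_eq_zero_iff.1 ⟨_, hne, h1⟩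
    exact lt_asymm hsmall (one_lt_norm_of_leftFactor_root hA hR hRW hT h3)
  rw [Matrix.sub_mulVec, Matrix.smul_mulVec, Matrix.one_mulVec, sub_eq_zero] at h2
  exact h2.symm

/-- The vectors of an eigensystem that belong to one root are linearly independent. -/
theorem IsEigenSystem.linearIndependent_fiber {A B : Matrix (Fin r) (Fin r) ℂ} {x : ℂ}
    {z : Fin (2 * r) → ℂ} {v : Fin (2 * r) → Fin r → ℂ} (hzv : IsEigenSystem A B x z v)
    (k : Fin (2 * r)) : LinearIndependent ℂ fun l : {l // z l = z k} => v l := by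
  classical
  rw [linearIndependent_iff_card_eq_finrank_span]
  have h1 : Set.range (fun l : {l // z l = z k} => v l) = v '' {l | z l = z k} := by
    ext w
    simp
  rw [Set.finrank, h1, hzv.span_dim, hzv.geom_eq_alg, algMult, ← Polynomial.count_roots,
    ← hzv.labelling.roots_eq, Multiset.count_map, Fintype.card_subtype]
  simp only [eq_comm (a := z k)]
  rfl

/-- Eigenspaces of `R` are independent, which reduces a vanishing combination to a single root;
there the multiplicity condition gives independence. -/
theorem linearIndependent_smallIdx {A B R : Matrix (Fin r) (Fin r) ℂ} {x : ℂ}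
    {z : Fin (2 * r) → ℂ} {v : Fin (2 * r) → Fin r → ℂ} (hzv : IsEigenSystem A B x z v)
    (hR : ∀ k : Fin r, R *ᵥ v (smallIdx k) = z (smallIdx k) • v (smallIdx k)) :
    LinearIndependent ℂ fun k : Fin r => v (smallIdx k) := by
  classical
  rw [Fintype.linearIndependent_iff]
  intro c hc k
  have hind := Module.End.eigenspaces_iSupIndep (R.mulVecLin)
  rw [iSupIndep_iff_finsetSum_eq_zero_imp_eq_zero] at hind
  set w : ℂ → Fin r → ℂ := fun μ =>
    ∑ k ∈ Finset.univ.filter (fun k => z (smallIdx k) = μ), c k • v (smallIdx k) with hw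
  have hmem : ∀ μ, w μ ∈ Module.End.eigenspace R.mulVecLin μ := fun μ =>
    Submodule.sum_mem _ fun k hk => Submodule.smul_mem _ _ <| by
      rw [Module.End.mem_eigenspace_iff, ← (Finset.mem_filter.1 hk).2]
      exact hR k
  have hsum : ∑ μ ∈ Finset.univ.image (fun k => z (smallIdx k)), w μ = 0 := by
    rw [← hc]
    exact Finset.sum_fiberwise_of_maps_to (fun k _ => Finset.mem_image_of_mem _ (Finset.mem_univ k)) _
  have hzero : w (z (smallIdx k)) = 0 :=
    hind _ _ (fun μ _ => hmem μ) hsum _ (Finset.mem_image_of_mem _ (Finset.mem_univ k))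
  have hfib : LinearIndependent ℂ
      fun l : {l : Fin r // z (smallIdx l) = z (smallIdx k)} => v (smallIdx l) :=
    (hzv.linearIndependent_fiber (smallIdx k)).comp
      (fun l : {l : Fin r // z (smallIdx l) = z (smallIdx k)} =>
        (⟨smallIdx l, l.2⟩ : {l // z l = z (smallIdx k)}))
      fun a b h => Subtype.ext (smallIdx_injective (congrArg Subtype.val h))
  rw [Fintype.linearIndependent_iff] at hfib
  refine hfib (fun l => c l) ?_ ⟨k, rfl⟩
  rw [← hzero, hw]
  exact (Finset.sum_subtype _ (by simp) fun l => c l • v (smallIdx l)).symm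

theorem isDiagonalizable_of_eigenvectors {R : Matrix (Fin r) (Fin r) ℂ} {u : Fin r → Fin r → ℂ}
    {d : Fin r → ℂ} (hu : LinearIndependent ℂ u) (hR : ∀ k, R *ᵥ u k = d k • u k) :
    IsDiagonalizable R := by
  set V : Matrix (Fin r) (Fin r) ℂ := (Matrix.of u)ᵀ with hV
  have hdet : IsUnit V.det := by
    rw [hV, Matrix.det_transpose, ← Matrix.isUnit_iff_isUnit_det]
    exact Matrix.linearIndependent_rows_iff_isUnit.1 hu
  refine ⟨V, d, hdet.ne_zero, ?_⟩
  have h1 : R * V = V * Matrix.diagonal d := by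
    ext i k
    rw [Matrix.mul_diagonal]
    have h2 := congrFun (hR k) i
    rw [Pi.smul_apply, smul_eq_mul, mul_comm] at h2
    exact h2
  rw [← h1, Matrix.mul_nonsing_inv_cancel_right _ _ hdet]

/-! ### Separable multiples -/

open Polynomial in
/-- A nonzero polynomial over a domain of characteristic zero divides a power of a polynomial which
is separable up to a constant. -/
theorem exists_dvd_pow_separable {S : Type*} [CommRing S] [IsDomain S] [CharZero S] {F : S[X]}
    (hF : F ≠ 0) : ∃ (Q a b : S[X]) (c : S) (n : ℕ), c ≠ 0 ∧ F ∣ Q ^ n ∧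
      a * Q + b * derivative Q = C c := by
  classical
  let K := FractionRing S
  have hinj : Function.Injective (algebraMap S K) := IsFractionRing.injective S K
  have : CharZero K := charZero_of_injective_algebraMap hinj
  have hinj' : Function.Injective (Polynomial.map (algebraMap S K)) :=
    Polynomial.map_injective _ hinj
  have hnorm : ∀ p : K[X], ∃ (q : S[X]) (b : S), b ≠ 0 ∧
      q.map (algebraMap S K) = C (algebraMap S K b) * p := by
    intro p
    obtain ⟨b, hb, h⟩ := IsLocalization.integerNormalization_spec (nonZeroDivisors S) p
    refine ⟨_, b, nonZeroDivisors.ne_zero hb, h.trans ?_⟩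
    rw [← algebraMap_smul K b p, Polynomial.smul_eq_C_mul]
  have hFK : F.map (algebraMap S K) ≠ 0 := (Polynomial.map_ne_zero_iff hinj).2 hF
  set q := UniqueFactorizationMonoid.radical (F.map (algebraMap S K)) with hq
  obtain ⟨n, u, hu⟩ := UniqueFactorizationMonoid.exists_dvd_radical_self_pow hFK
  have hsep : q.Separable :=
    PerfectField.separable_iff_squarefree.2 UniqueFactorizationMonoid.squarefree_radical
  obtain ⟨a, b, hab⟩ := hsep
  obtain ⟨Q, c1, hc1, hQ⟩ := hnorm q
  obtain ⟨U, c2, hc2, hU⟩ := hnorm u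
  obtain ⟨a', c3, hc3, ha'⟩ := hnorm a
  obtain ⟨b', c4, hc4, hb'⟩ := hnorm b
  -- Exponent `n + 1` instead of `n` ensures a factor `c2` to clear the denominators of the cofactor
  -- `u`, even when `n = 0`.
  refine ⟨C c2 * Q, C c4 * a', C c3 * b', c1 * c2 * c3 * c4, n + 1, by positivity, ?_, ?_⟩
  · have h1 : (C c2 * Q) ^ (n + 1) = F * (C (c2 ^ n * c1 ^ n) * U * Q) := by
      apply hinj'
      simp only [Polynomial.map_pow, Polynomial.map_mul, Polynomial.map_C, hQ, hU, map_mul,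
        map_pow]
      have h2 : q ^ n = F.map (algebraMap S K) * u := hu
      calc (C (algebraMap S K c2) * (C (algebraMap S K c1) * q)) ^ (n + 1)
          = C (algebraMap S K c2) ^ (n + 1) * C (algebraMap S K c1) ^ (n + 1) * q * q ^ n := by
            ring
        _ = _ := by rw [h2]; ring
    exact ⟨_, h1⟩
  · apply hinj'
    simp only [Polynomial.map_add, Polynomial.map_mul, Polynomial.map_C, hQ, ha', hb', map_mul,
      ← Polynomial.derivative_map, Polynomial.derivative_mul, Polynomial.derivative_C, zero_mul,
      zero_add]
    calc _ = C (algebraMap S K c1) * C (algebraMap S K c2) * C (algebraMap S K c3) *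
          C (algebraMap S K c4) * (a * q + b * derivative q) := by ring
      _ = _ := by rw [hab, mul_one]

/-! ### Geometric and algebraic multiplicities -/

-- Constant matrices of determinant one bring `L(w)` to diagonal form. Every column of the
-- transformed `L` with zero diagonal entry at `w` is then divisible by `X - w`, and there are as
-- many such columns as the dimension of the kernel.
open Polynomial in
theorem pow_finrank_ker_dvd_det (L : Matrix (Fin r) (Fin r) ℂ[X]) (w : ℂ) :
    (X - C w) ^ Module.finrank ℂ (LinearMap.ker (L.map (eval w)).mulVecLin) ∣ L.det := by
  classical
  obtain ⟨P, P', D, h⟩ :=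
    Matrix.Pivot.exists_list_transvec_mul_mul_list_transvec_eq_diagonal (L.map (eval w))
  set V := (P.map Matrix.TransvectionStruct.toMatrix).prod with hV
  set V' := (P'.map Matrix.TransvectionStruct.toMatrix).prod with hV'
  have hdV : V.det = 1 := Matrix.TransvectionStruct.det_toMatrix_prod P
  have hdV' : V'.det = 1 := Matrix.TransvectionStruct.det_toMatrix_prod P'
  set T := V.map C * L * V'.map C with hT
  have hCdet : ∀ Y : Matrix (Fin r) (Fin r) ℂ, (Y.map C).det = C Y.det := fun Y => by
    rw [RingHom.map_det]; rfl
  have hdet : T.det = L.det := by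
    rw [hT, Matrix.det_mul, Matrix.det_mul, hCdet, hCdet, hdV, hdV', map_one, one_mul, mul_one]
  have hTe : T.map (eval w) = Matrix.diagonal D := by
    rw [← h, hT]
    have h1 : ∀ Y : Matrix (Fin r) (Fin r) ℂ[X],
        Y.map (eval w) = (evalRingHom w).mapMatrix Y := fun _ => rfl
    rw [h1, map_mul, map_mul, ← h1]
    congr 2
    · ext i j; simp
    · ext i j; simp
  have hdvd : ∀ i j, ∃ g, T i j = (if D j = 0 then X - C w else 1) * g := by
    intro i j
    split_ifs with hD
    · have h2 : (T i j).eval w = 0 := by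
        have h3 := congrFun (congrFun hTe i) j
        rw [Matrix.map_apply] at h3
        rw [h3, Matrix.diagonal_apply]
        split_ifs with hij
        · rw [hij, hD]
        · rfl
      exact dvd_iff_isRoot.2 h2
    · exact ⟨T i j, (one_mul _).symm⟩
  choose G hG using hdvd
  have hT2 : T = Matrix.of fun i j => (if D j = 0 then X - C w else 1) * (Matrix.of G) i j := by
    ext1 i j
    exact hG i j
  rw [← hdet, hT2, Matrix.det_mul_row, Finset.prod_ite, Finset.prod_const_one, mul_one,
    Finset.prod_const]
  refine Dvd.dvd.mul_right (pow_dvd_pow _ (le_of_eq ?_)) _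
  have hrank : (L.map (eval w)).rank = Fintype.card {i // D i ≠ 0} := by
    rw [← Matrix.rank_diagonal, ← h, Matrix.rank_mul_eq_left_of_det_ne_zero _ _ (by simp [hdV']),
      Matrix.rank_mul_eq_right_of_det_ne_zero _ _ (by simp [hdV])]
  have h4 := (L.map (eval w)).mulVecLin.finrank_range_add_finrank_ker
  rw [← Matrix.rank, hrank, Module.finrank_fin_fun, Fintype.card_subtype] at h4
  have h5 := Finset.card_filter_add_card_filter_not (s := (Finset.univ : Finset (Fin r)))
    (fun i => D i = 0)
  rw [Finset.card_univ, Fintype.card_fin] at h5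
  simp only [ne_eq] at h4
  omega

/-- The matrix polynomial `Z² A^* + Z (B - x) + A`. -/
def symbolMatrix (A B : Matrix (Fin r) (Fin r) ℂ) (x : ℂ) :
    Matrix (Fin r) (Fin r) (Polynomial ℂ) :=
  ((Polynomial.X : Polynomial ℂ) ^ 2) • (Aᴴ).map Polynomial.C
    + (Polynomial.X : Polynomial ℂ) •
      (B - x • (1 : Matrix (Fin r) (Fin r) ℂ)).map Polynomial.C
    + A.map Polynomial.C

theorem symbolMatrix_eval (A B : Matrix (Fin r) (Fin r) ℂ) (x : ℂ) {w : ℂ} (hw : w ≠ 0) :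
    (symbolMatrix A B x).map (Polynomial.eval w) = w • pencil A B w x := by
  ext i j
  simp only [symbolMatrix, pencil, Matrix.map_apply, Matrix.add_apply,
    Matrix.sub_apply, Matrix.smul_apply, smul_eq_mul,
    Polynomial.eval_add, Polynomial.eval_mul, Polynomial.eval_pow, Polynomial.eval_X,
    Polynomial.eval_C]
  field_simp
  ring

theorem geomMult_eq (A B : Matrix (Fin r) (Fin r) ℂ) (x : ℂ) {w : ℂ} (hw : w ≠ 0) :
    geomMult A B w x = Module.finrank ℂ
      (LinearMap.ker ((symbolMatrix A B x).map (Polynomial.eval w)).mulVecLin) := by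
  have h : LinearMap.ker (w • pencil A B w x).mulVecLin =
      LinearMap.ker (pencil A B w x).mulVecLin := by
    ext v
    simp only [LinearMap.mem_ker, Matrix.mulVecLin_apply, Matrix.smul_mulVec]
    exact smul_eq_zero_iff_right hw
  rw [geomMult, symbolMatrix_eval _ _ _ hw, h]

-- Write `L G = q`. Each kernel dimension at `w` is at most the order of the determinant there, and
-- the two orders add up to `r` times the order of `q`, hence to at most `r`. The range of `G(w)`
-- lies in the kernel of `L(w)`, so the kernel dimensions add up to at least `r`, and equality holds
-- throughout.
open Polynomial in
theorem geomMult_eq_algMult_of_mul_eq {A B : Matrix (Fin r) (Fin r) ℂ} {x w : ℂ} (hw : w ≠ 0)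
    {G : Matrix (Fin r) (Fin r) ℂ[X]} {q : ℂ[X]} (hq0 : q ≠ 0)
    (hG : symbolMatrix A B x * G = q • (1 : Matrix (Fin r) (Fin r) ℂ[X]))
    (hq : q.rootMultiplicity w ≤ 1) (hroot : (symbolPoly A B x).IsRoot w) :
    geomMult A B w x = algMult A B w x := by
  set L := symbolMatrix A B x with hL
  have hLdet : L.det = symbolPoly A B x := rfl
  have hdet : L.det * G.det = q ^ r := by
    rw [← Matrix.det_mul, hG, Matrix.det_smul, Matrix.det_one, mul_one, Fintype.card_fin]
  have hne : L.det * G.det ≠ 0 := hdet ▸ pow_ne_zero _ hq0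
  have hmult := rootMultiplicity_mul (x := w) hne
  rw [hdet, ← count_roots, roots_pow, Multiset.count_nsmul, count_roots] at hmult
  have h1 := (le_rootMultiplicity_iff (left_ne_zero_of_mul hne)).2 (pow_finrank_ker_dvd_det L w)
  have h2 := (le_rootMultiplicity_iff (right_ne_zero_of_mul hne)).2 (pow_finrank_ker_dvd_det G w)
  have hev : ∀ Y : Matrix (Fin r) (Fin r) ℂ[X],
      Y.map (eval w) = (evalRingHom w).mapMatrix Y := fun _ => rfl
  have hqw : r ≠ 0 → q.eval w = 0 := by
    intro hr
    have h3 := congrArg (eval w) hdet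
    rw [eval_mul, hLdet, hroot, zero_mul, eval_pow] at h3
    exact pow_eq_zero_iff hr |>.1 h3.symm
  have hmul : L.map (eval w) * G.map (eval w) = 0 := by
    rcases eq_or_ne r 0 with rfl | hr
    · ext i; exact i.elim0
    · rw [hev, hev, ← map_mul, hG, ← hev]
      ext i j
      simp [hqw hr]
  have hrange : LinearMap.range (G.map (eval w)).mulVecLin ≤
      LinearMap.ker (L.map (eval w)).mulVecLin := by
    rintro _ ⟨v, rfl⟩
    rw [LinearMap.mem_ker, Matrix.mulVecLin_apply, Matrix.mulVecLin_apply, Matrix.mulVec_mulVec,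
      hmul, Matrix.zero_mulVec]
  have h4 := Submodule.finrank_mono hrange
  have h5 := (G.map (eval w)).mulVecLin.finrank_range_add_finrank_ker
  rw [Module.finrank_fin_fun] at h5
  rw [geomMult_eq _ _ _ hw, algMult, ← hLdet, ← hL]
  have h6 : r * q.rootMultiplicity w ≤ r := by nlinarith
  omega

/-! ### Hermitian matrices satisfy squarefree equations -/

theorem aeval_unitary_conj {ι : Type*} [Fintype ι] [DecidableEq ι] {U : Matrix ι ι ℂ}
    (hU : Uᴴ * U = 1) (hU' : U * Uᴴ = 1) (g : ι → ℂ) (p : Polynomial ℂ) :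
    Polynomial.aeval (U * Matrix.diagonal g * Uᴴ) p =
      U * Matrix.diagonal (fun i => p.eval (g i)) * Uᴴ := by
  induction p using Polynomial.induction_on' with
  | add p q hp hq =>
    rw [map_add, hp, hq, ← add_mul, ← mul_add, Matrix.diagonal_add]
    simp only [Polynomial.eval_add]
  | monomial n a =>
    rw [Polynomial.aeval_monomial, unitary_conj_pow hU hU', ← Algebra.smul_def, ← smul_mul_assoc,
      ← mul_smul_comm, ← Matrix.diagonal_smul]
    simp only [Polynomial.eval_monomial]
    rfl

/-- A polynomial in a Hermitian matrix is unitarily diagonalizable, so it is zero if nilpotent. -/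
theorem aeval_eq_zero_of_pow {H : Matrix (Fin r) (Fin r) ℂ} (hH : H.IsHermitian)
    {p : Polynomial ℂ} {n : ℕ} (h : Polynomial.aeval H p ^ n = 0) : Polynomial.aeval H p = 0 := by
  set U : Matrix (Fin r) (Fin r) ℂ := hH.eigenvectorUnitary.1 with hUdef
  have hU : Uᴴ * U = 1 := Unitary.coe_star_mul_self hH.eigenvectorUnitary
  have hU' : U * Uᴴ = 1 := Unitary.coe_mul_star_self hH.eigenvectorUnitary
  have hspec : H = U * Matrix.diagonal (fun m => (hH.eigenvalues m : ℂ)) * Uᴴ := by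
    have h := hH.spectral_theorem
    rw [Unitary.conjStarAlgAut_apply] at h
    exact h
  rw [hspec, aeval_unitary_conj hU hU'] at h ⊢
  rw [unitary_conj_pow hU hU'] at h
  set g : Fin r → ℂ := fun i => p.eval (hH.eigenvalues i : ℂ) with hg
  have h1 : Matrix.diagonal (g ^ n) = 0 := by
    calc Matrix.diagonal (g ^ n) = (Uᴴ * U) * Matrix.diagonal (g ^ n) * (Uᴴ * U) := by
          rw [hU, one_mul, mul_one]
      _ = Uᴴ * (U * Matrix.diagonal (g ^ n) * Uᴴ) * U := by simp only [mul_assoc]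
      _ = 0 := by rw [h, mul_zero, zero_mul]
  have h2 : g = 0 := by
    ext i
    have h3 := congrFun (congrFun h1 i) i
    rw [Matrix.diagonal_apply_eq, Pi.pow_apply, Matrix.zero_apply] at h3
    exact eq_zero_of_pow_eq_zero h3
  rw [h2]
  have h4 : Matrix.diagonal (0 : Fin r → ℂ) = 0 := Matrix.diagonal_zero
  rw [h4, mul_zero, zero_mul]

theorem pencil_isHermitian {A B : Matrix (Fin r) (Fin r) ℂ} (hB : B.IsHermitian) {w : ℂ}
    (hw : ‖w‖ = 1) : (pencil A B w 0).IsHermitian := by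
  have h1 : star w = w⁻¹ := by
    rw [Complex.inv_def, Complex.normSq_eq_norm_sq, hw]
    simp
  have h2 : star w⁻¹ = w := by rw [← h1, star_star]
  rw [Matrix.IsHermitian, pencil, zero_smul, sub_zero, Matrix.conjTranspose_add,
    Matrix.conjTranspose_add, Matrix.conjTranspose_smul, Matrix.conjTranspose_smul,
    Matrix.conjTranspose_conjTranspose, hB.eq, h1, h2]
  abel

/-! ### Finiteness of the exceptional set -/

open Polynomial in
/-- `det (Y² A^* + Y (B - X) + A)` as a polynomial in `Y` over `ℂ[X]`. -/
def bivariateSymbol (A B : Matrix (Fin r) (Fin r) ℂ) : ℂ[X][X] :=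
  ((X : ℂ[X][X]) ^ 2 • (Aᴴ).map (fun c => C (C c)) +
    (X : ℂ[X][X]) • (B.map (fun c => C (C c)) -
      (C X : ℂ[X][X]) • (1 : Matrix (Fin r) (Fin r) ℂ[X][X])) +
    A.map (fun c => C (C c))).det

open Polynomial in
theorem bivariateSymbol_map (A B : Matrix (Fin r) (Fin r) ℂ) (x : ℂ) :
    (bivariateSymbol A B).map (evalRingHom x) = symbolPoly A B x := by
  rw [bivariateSymbol, ← coe_mapRingHom, RingHom.map_det, symbolPoly]
  congr 1
  ext1 i j
  simp only [RingHom.mapMatrix_apply, Matrix.map_apply, Matrix.add_apply, Matrix.sub_apply,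
    Matrix.smul_apply, smul_eq_mul, coe_mapRingHom, Polynomial.map_add, Polynomial.map_mul,
    Polynomial.map_sub, Polynomial.map_pow, Polynomial.map_X, Polynomial.map_C, coe_evalRingHom,
    eval_C, eval_X, Matrix.one_apply, map_sub, map_mul]
  split_ifs <;> simp

-- Fixing `Y = w` turns the symbol into a multiple of a characteristic polynomial, which makes
-- Cayley–Hamilton available on the unit circle.
open Polynomial in
theorem bivariateSymbol_eval (A B : Matrix (Fin r) (Fin r) ℂ) {w : ℂ} (hw : w ≠ 0) :
    (bivariateSymbol A B).eval (C w) = C ((-w) ^ r) * (pencil A B w 0).charpoly := by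
  have h1 : C ((-w) ^ r) * (pencil A B w 0).charpoly =
      ((C (-w)) • (pencil A B w 0).charmatrix).det := by
    rw [Matrix.det_smul, Fintype.card_fin, Matrix.charpoly, map_pow]
  rw [h1, bivariateSymbol, ← coe_evalRingHom, RingHom.map_det]
  congr 1
  ext1 i j
  have h2 : (C w : ℂ[X]) * C w⁻¹ = 1 := by rw [← C_mul, mul_inv_cancel₀ hw, C_1]
  simp only [RingHom.mapMatrix_apply, Matrix.map_apply, Matrix.add_apply, Matrix.sub_apply,
    Matrix.smul_apply, smul_eq_mul, coe_evalRingHom, eval_mul, eval_sub, eval_pow,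
    eval_X, eval_C, Matrix.charmatrix_apply, pencil, zero_smul, sub_zero, Matrix.one_apply,
    map_add, map_mul, map_neg, Matrix.diagonal_apply]
  split_ifs
  · simp only [eval_one]
    linear_combination -(C (A i j)) * h2
  · simp only [eval_zero]
    linear_combination -(C (A i j)) * h2

open Polynomial in
theorem swap_eval_C (Q : ℂ[X][X]) (x : ℂ) :
    (Bivariate.swap Q).eval (C x) = Q.map (evalRingHom x) := by
  have h : (evalRingHom (C x : ℂ[X])).comp ((Bivariate.swap (R := ℂ)).toRingEquiv.toRingHom) =
      mapRingHom (evalRingHom x) := by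
    ext <;> simp [Bivariate.swap_apply]
  exact congrArg (fun f => f Q) h

open Polynomial in
theorem swap_map_eval (Q : ℂ[X][X]) (w : ℂ) :
    (Bivariate.swap Q).map (evalRingHom w) = Q.eval (C w) := by
  rw [← swap_eval_C, Bivariate.swap_swap_apply]

open Polynomial in
theorem aeval_pencil_eq_zero {A B : Matrix (Fin r) (Fin r) ℂ} (hB : B.IsHermitian)
    {Q : ℂ[X][X]} {n : ℕ} (hQ : bivariateSymbol A B ∣ Q ^ n) {w : ℂ} (hw : ‖w‖ = 1) :
    aeval (pencil A B w 0) (Q.eval (C w)) = 0 := by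
  have hw0 : w ≠ 0 := fun h => by rw [h, norm_zero] at hw; exact zero_ne_one hw
  refine aeval_eq_zero_of_pow (pencil_isHermitian hB hw) (n := n) ?_
  obtain ⟨k, hk⟩ := hQ
  rw [← map_pow, ← eval_pow, hk, eval_mul, bivariateSymbol_eval A B hw0, map_mul, map_mul,
    Matrix.aeval_self_charpoly, mul_zero, zero_mul]

theorem infinite_norm_eq_one : {w : ℂ | ‖w‖ = 1}.Infinite := by
  have h1 : IsPreconnected (Metric.sphere (0 : ℂ) 1) :=
    isPreconnected_sphere (by rw [Complex.rank_real_complex]; norm_num) 0 1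
  have h2 : (Metric.sphere (0 : ℂ) 1).Infinite :=
    h1.infinite_of_nontrivial ⟨1, by simp, -1, by simp, by norm_num⟩
  convert h2 using 1
  ext w
  simp

open Polynomial in
theorem symbolMatrix_eq_sub (A B : Matrix (Fin r) (Fin r) ℂ) (x : ℂ) :
    symbolMatrix A B x = symbolMatrix A B 0 -
      algebraMap ℂ[X] (Matrix (Fin r) (Fin r) ℂ[X]) (X * C x) := by
  ext1 i j
  simp only [symbolMatrix, Matrix.map_apply, Matrix.add_apply, Matrix.sub_apply, Matrix.smul_apply,
    smul_eq_mul, Matrix.algebraMap_matrix_apply, Matrix.one_apply, map_sub]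
  split_ifs
  · simp
    ring
  · simp

-- With `L_0(Z) = Z² A^* + Z B + A`, one has `L_0(w) = w H(w)` with `H(w)` Hermitian on the unit
-- circle. Scaling the roots by `Z` absorbs the factor `w`, so that `Q(H(w), w) = 0` becomes an
-- identity free of `w⁻¹`.
open Polynomial in
theorem aeval_symbolMatrix_scaleRoots {A B : Matrix (Fin r) (Fin r) ℂ} (hB : B.IsHermitian)
    {Q : ℂ[X][X]} {n : ℕ} (hQ : bivariateSymbol A B ∣ Q ^ n) :
    aeval (symbolMatrix A B 0) ((Bivariate.swap Q).scaleRoots X) = 0 := by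
  ext1 i j
  rw [Matrix.zero_apply]
  -- Each entry is a polynomial in `Z`, so vanishing on the infinite unit circle suffices.
  refine eq_zero_of_infinite_isRoot _ (infinite_norm_eq_one.mono fun w hw => ?_)
  have hw1 : ‖w‖ = 1 := hw
  have hw0 : w ≠ 0 := fun h => by rw [h, norm_zero] at hw1; exact zero_ne_one hw1
  set φ : ℂ[X] →+* Matrix (Fin r) (Fin r) ℂ :=
    (algebraMap ℂ (Matrix (Fin r) (Fin r) ℂ)).comp (evalRingHom w) with hφ
  have hcomp : (evalRingHom w).mapMatrix.comp (algebraMap ℂ[X] (Matrix (Fin r) (Fin r) ℂ[X]))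
      = φ := by
    refine RingHom.ext fun p => ?_
    ext a b
    simp only [RingHom.comp_apply, RingHom.mapMatrix_apply, Matrix.map_apply, hφ,
      Matrix.algebraMap_matrix_apply, Algebra.algebraMap_self, RingHom.id_apply]
    split_ifs <;> simp
  have hφX : φ X = w • (1 : Matrix (Fin r) (Fin r) ℂ) := by
    rw [hφ, RingHom.comp_apply, coe_evalRingHom, eval_X, Algebra.algebraMap_eq_smul_one]
  have hcomm : ∀ p (Y : Matrix (Fin r) (Fin r) ℂ), Commute (φ p) Y := fun p Y =>
    Algebra.commutes (p.eval w) Y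
  have key : (evalRingHom w).mapMatrix
      (aeval (symbolMatrix A B 0) ((Bivariate.swap Q).scaleRoots X)) = 0 := by
    rw [aeval_def, hom_eval₂, hcomp]
    have h1 : (evalRingHom w).mapMatrix (symbolMatrix A B 0) = φ X * pencil A B w 0 := by
      rw [hφX, smul_mul_assoc, one_mul]
      exact symbolMatrix_eval A B 0 hw0
    rw [h1, scaleRoots_eval₂_mul_of_commute _ _ _ (hcomm _ _) fun _ _ => hcomm _ _, hφ,
      ← eval₂_map, swap_map_eval, ← aeval_def, aeval_pencil_eq_zero hB hQ hw1, mul_zero]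
  exact congrFun (congrFun key i) j

open Polynomial in
/-- The matrix polynomial `Z² A^* + Z (B - x) + A` divides the scalar polynomial `Z ^ d Q(x, Z)`
whenever `Q` is a multiple of the radical of the symbol. -/
theorem exists_scalar_multiple {A B : Matrix (Fin r) (Fin r) ℂ} (hB : B.IsHermitian)
    {Q : ℂ[X][X]} {n : ℕ} (hQ : bivariateSymbol A B ∣ Q ^ n) (x : ℂ) :
    ∃ (G : Matrix (Fin r) (Fin r) ℂ[X]) (d : ℕ), symbolMatrix A B x * G =
      (X ^ d * Q.map (evalRingHom x)) • (1 : Matrix (Fin r) (Fin r) ℂ[X]) := by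
  set S := (Bivariate.swap Q).scaleRoots X with hS
  -- Factor theorem at the scalar `Z x`: substituting `L_0` for the variable kills `S`, turns `T - Z
  -- x` into the matrix polynomial at `x`, and leaves `S(Z x) = Z^d Q(x, Z)`.
  obtain ⟨k, hk⟩ := X_sub_C_dvd_sub_C_eval (a := X * C x) (p := S)
  refine ⟨-aeval (symbolMatrix A B 0) k, (Bivariate.swap Q).natDegree, ?_⟩
  have h1 := congrArg (aeval (symbolMatrix A B 0)) hk
  rw [map_sub, map_mul, map_sub, aeval_X, aeval_C, aeval_C, hS,
    aeval_symbolMatrix_scaleRoots hB hQ, scaleRoots_eval_mul, swap_eval_C,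
    ← symbolMatrix_eq_sub, zero_sub] at h1
  rw [mul_neg, ← h1, neg_neg, Algebra.algebraMap_eq_smul_one]

theorem finite_geomMult_ne_algMult {A B : Matrix (Fin r) (Fin r) ℂ} (hA : A.det ≠ 0)
    (hB : B.IsHermitian) :
    {x | ∃ w, (symbolPoly A B x).IsRoot w ∧ geomMult A B w x ≠ algMult A B w x}.Finite := by
  have hF : bivariateSymbol A B ≠ 0 := fun h => by
    have h1 := bivariateSymbol_map A B 0
    rw [h, Polynomial.map_zero] at h1
    exact symbolPoly_ne_zero hA B 0 h1.symm
  obtain ⟨Q, a, b, c, n, hc, hdvd, hab⟩ := exists_dvd_pow_separable hF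
  -- Outside the zeros of `c`, the identity `a Q + b Q' = c` specializes to separability of `Q(x,
  -- ·)`.
  refine (Polynomial.finite_setOfPred_isRoot hc).subset ?_
  rintro x ⟨w, hw, hne⟩
  by_contra hx
  apply hne
  have hcx : c.eval x ≠ 0 := hx
  have hw0 : w ≠ 0 := by
    rintro rfl
    rw [Polynomial.IsRoot, symbolPoly_eval_zero] at hw
    exact hA hw
  set q := Q.map (Polynomial.evalRingHom x) with hq
  have hsep : q.Separable := by
    have h1 := congrArg (Polynomial.map (Polynomial.evalRingHom x)) hab
    rw [Polynomial.map_add, Polynomial.map_mul, Polynomial.map_mul, ← Polynomial.derivative_map,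
      Polynomial.map_C, Polynomial.coe_evalRingHom, ← hq] at h1
    refine ⟨Polynomial.C (c.eval x)⁻¹ * a.map (Polynomial.evalRingHom x),
      Polynomial.C (c.eval x)⁻¹ * b.map (Polynomial.evalRingHom x), ?_⟩
    rw [mul_assoc, mul_assoc, ← mul_add, h1, ← Polynomial.C_mul, inv_mul_cancel₀ hcx,
      Polynomial.C_1]
  obtain ⟨G, d, hG⟩ := exists_scalar_multiple hB hdvd x
  have hqne : Polynomial.X ^ d * q ≠ 0 :=
    mul_ne_zero (pow_ne_zero _ Polynomial.X_ne_zero) hsep.ne_zero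
  refine geomMult_eq_algMult_of_mul_eq hw0 hqne hG ?_ hw
  -- The factor `Z^d` does not contribute at `w ≠ 0`.
  rw [Polynomial.rootMultiplicity_mul hqne, Polynomial.rootMultiplicity_eq_zero
    (p := Polynomial.X ^ d) (by simp [hw0]), zero_add]
  exact Polynomial.rootMultiplicity_le_one_of_separable hsep w

/-! ### Existence of eigensystems -/

/-- The coefficient of `Z^{2r}` is `det A^*`, so there are exactly `2r` roots to label. -/
theorem natDegree_symbolPoly {A : Matrix (Fin r) (Fin r) ℂ} (hA : A.det ≠ 0)
    (B : Matrix (Fin r) (Fin r) ℂ) (x : ℂ) : (symbolPoly A B x).natDegree = 2 * r := by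
  have hent : ∀ i j, (symbolMatrix A B x i j).natDegree ≤ 2 := by
    intro i j
    simp only [symbolMatrix, Matrix.add_apply, Matrix.smul_apply, Matrix.map_apply, smul_eq_mul]
    compute_degree
  have hco : ∀ i j, (symbolMatrix A B x i j).coeff 2 = Aᴴ i j := by
    intro i j
    simp only [symbolMatrix, Matrix.add_apply, Matrix.smul_apply, Matrix.map_apply, smul_eq_mul]
    simp
  have hpoly : symbolPoly A B x = (symbolMatrix A B x).det := rfl
  have hle : (symbolPoly A B x).natDegree ≤ 2 * r := by
    rw [hpoly, Matrix.det_apply]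
    refine Polynomial.natDegree_sum_le_of_forall_le _ _ fun σ _ => ?_
    refine (Polynomial.natDegree_smul_le _ _).trans ((Polynomial.natDegree_prod_le _ _).trans ?_)
    refine (Finset.sum_le_card_nsmul _ _ 2 fun i _ => hent _ _).trans ?_
    simp [mul_comm]
  have hcoeff : (symbolPoly A B x).coeff (2 * r) = (Aᴴ).det := by
    rw [hpoly, Matrix.det_apply, Matrix.det_apply, Polynomial.finsetSum_coeff]
    refine Finset.sum_congr rfl fun σ _ => ?_
    rw [Polynomial.coeff_smul]
    congr 1
    have h1 := Polynomial.coeff_prod_of_natDegree_le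
      (fun i => symbolMatrix A B x (σ i) i) (s := Finset.univ) 2 fun i _ => hent _ _
    rw [Finset.card_univ, Fintype.card_fin, mul_comm] at h1
    rw [h1]
    exact Finset.prod_congr rfl fun i _ => hco _ _
  refine le_antisymm hle (Polynomial.le_natDegree_of_ne_zero ?_)
  rw [hcoeff, Matrix.det_conjTranspose]
  simpa using hA

theorem exists_map_univ_eq {α : Type*} (S : Multiset α) {n : ℕ} (h : S.card = n) :
    ∃ z : Fin n → α, (Finset.univ : Finset (Fin n)).val.map z = S := by
  obtain ⟨L, rfl⟩ : ∃ L : List α, (L : Multiset α) = S := ⟨S.toList, S.coe_toList⟩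
  rw [Multiset.coe_card] at h
  subst h
  exact ⟨L.get, by rw [Fin.univ_val_map, List.ofFn_get]⟩

theorem exists_isRootLabelling {A : Matrix (Fin r) (Fin r) ℂ} (hA : A.det ≠ 0)
    (B : Matrix (Fin r) (Fin r) ℂ) (x : ℂ) : ∃ z, IsRootLabelling A B x z := by
  have hcard : (symbolPoly A B x).roots.card = 2 * r := by
    rw [← (IsAlgClosed.splits _).natDegree_eq_card_roots, natDegree_symbolPoly hA]
  obtain ⟨z, hz⟩ := exists_map_univ_eq _ hcard
  set σ := Tuple.sort fun k => ‖z k‖ with hσ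
  refine ⟨z ∘ σ, ?_, Tuple.monotone_sort fun k => ‖z k‖⟩
  rw [← hz, ← Multiset.map_map, Multiset.map_univ_val_equiv]

theorem exists_unit_linearIndependent (K : Submodule ℂ (Fin r → ℂ)) {ι : Type*} [Fintype ι]
    (h : Fintype.card ι ≤ Module.finrank ℂ K) :
    ∃ u : ι → Fin r → ℂ, (∀ l, u l ∈ K) ∧ (∀ l, ∑ i, ‖u l i‖ ^ 2 = 1) ∧
      LinearIndependent ℂ u := by
  obtain ⟨e⟩ : Nonempty (ι ↪ Fin (Module.finrank ℂ K)) := by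
    rw [Function.Embedding.nonempty_iff_card_le, Fintype.card_fin]
    exact h
  set b : ι → Fin r → ℂ := fun l => (Module.finBasis ℂ K (e l) : Fin r → ℂ) with hb
  have hind : LinearIndependent ℂ b :=
    ((Module.finBasis ℂ K).linearIndependent.comp e e.injective).map' K.subtype
      (Submodule.ker_subtype K)
  have hpos : ∀ l, 0 < ∑ i, ‖b l i‖ ^ 2 := by
    intro l
    obtain ⟨i, hi⟩ := Function.ne_iff.1 (hind.ne_zero l)
    exact Finset.sum_pos' (fun _ _ => by positivity)
      ⟨i, Finset.mem_univ i, by have := norm_pos_iff.2 hi; positivity⟩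
  have hne : ∀ l, (((√(∑ i, ‖b l i‖ ^ 2))⁻¹ : ℝ) : ℂ) ≠ 0 := fun l => by
    have := Real.sqrt_pos.2 (hpos l)
    exact_mod_cast inv_ne_zero this.ne'
  refine ⟨fun l => (((√(∑ i, ‖b l i‖ ^ 2))⁻¹ : ℝ) : ℂ) • b l,
    fun l => K.smul_mem _ (Subtype.mem _), fun l => ?_,
    hind.units_smul fun l => Units.mk0 _ (hne l)⟩
  simp only [Pi.smul_apply, smul_eq_mul, norm_mul, mul_pow, ← Finset.mul_sum]
  rw [Complex.norm_real, Real.norm_eq_abs, sq_abs, inv_pow, Real.sq_sqrt (hpos l).le,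
    inv_mul_cancel₀ (hpos l).ne']

theorem exists_isEigenSystem {A B : Matrix (Fin r) (Fin r) ℂ} (hA : A.det ≠ 0) {x : ℂ}
    (h : ∀ w, (symbolPoly A B x).IsRoot w → geomMult A B w x = algMult A B w x) :
    ∃ z v, IsEigenSystem A B x z v := by
  classical
  obtain ⟨z, hz⟩ := exists_isRootLabelling hA B x
  -- Each root labels as many indices as its algebraic multiplicity; when this equals the kernel
  -- dimension, a unit basis of the kernel can be distributed over those indices.
  have hcard : ∀ w, Fintype.card {l // z l = w} = algMult A B w x := by
    intro w
    rw [algMult, ← Polynomial.count_roots, ← hz.roots_eq, Multiset.count_map,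
      Fintype.card_subtype]
    simp only [eq_comm (a := w)]
    rfl
  have hgeom : ∀ k, geomMult A B (z k) x = algMult A B (z k) x := fun k => by
    apply h
    have h1 : z k ∈ (symbolPoly A B x).roots := by
      rw [← hz.roots_eq]
      exact Multiset.mem_map_of_mem z (Finset.mem_univ k)
    exact (Polynomial.mem_roots'.1 h1).2
  have hex : ∀ w, ∃ u : {l // z l = w} → Fin r → ℂ,
      (∀ l, u l ∈ LinearMap.ker (pencil A B w x).mulVecLin) ∧
      (∀ l, ∑ i, ‖u l i‖ ^ 2 = 1) ∧ LinearIndependent ℂ u := by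
    intro w
    apply exists_unit_linearIndependent
    by_cases hw : ∃ k, z k = w
    · obtain ⟨k, rfl⟩ := hw
      rw [hcard, ← hgeom]
      rfl
    · have : IsEmpty {l // z l = w} := ⟨fun l => hw ⟨l.1, l.2⟩⟩
      simp
  choose u hu1 hu2 hu3 using hex
  have hv : ∀ w l (hl : z l = w), u (z l) ⟨l, rfl⟩ = u w ⟨l, hl⟩ := by
    rintro w l rfl
    rfl
  refine ⟨z, fun l => u (z l) ⟨l, rfl⟩, hz, fun k => hu2 _ _, fun k => hu1 (z k) ⟨k, rfl⟩,
    fun k => ?_, hgeom⟩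
  have himg : (fun l => u (z l) ⟨l, rfl⟩) '' {l | z l = z k} = Set.range (u (z k)) := by
    ext y
    constructor
    · rintro ⟨l, hl, rfl⟩
      exact ⟨⟨l, hl⟩, (hv _ l hl).symm⟩
    · rintro ⟨⟨l, hl⟩, rfl⟩
      exact ⟨l, hl, hv _ l hl⟩
  rw [himg, finrank_span_eq_card (hu3 (z k)), hcard, hgeom]

theorem finite_exceptionalSet {A B : Matrix (Fin r) (Fin r) ℂ} (hA : A.det ≠ 0)
    (hB : B.IsHermitian) : (exceptionalSet A B).Finite := by
  refine (finite_geomMult_ne_algMult hA hB).subset fun x hx => ?_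
  by_contra hne
  refine hx (exists_isEigenSystem hA fun w hw => ?_)
  by_contra h
  exact hne ⟨w, hw, h⟩

/-! ### Uniform convergence -/

theorem tendstoUniformlyOn_of_prod_nhds {α X Y : Type*} [TopologicalSpace X]
    [PseudoMetricSpace Y] {l : Filter α} [l.NeBot] {F : α → X → Y} {f : X → Y} {K : Set X}
    (hK : IsCompact K)
    (h : ∀ x ∈ K, Tendsto (fun q : α × X => F q.1 q.2) (l ×ˢ 𝓝 x) (𝓝 (f x))) :
    TendstoUniformlyOn F f l K := by
  rw [← tendstoLocallyUniformlyOn_iff_tendstoUniformlyOn_of_compact hK,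
    Metric.tendstoLocallyUniformlyOn_iff]
  intro ε hε x hx
  obtain ⟨S, hS, V, hV, hSV⟩ := eventually_prod_iff.1
    (Metric.tendsto_nhds.1 (h x hx) (ε / 3) (by positivity))
  refine ⟨{y | V y} ∩ K, inter_mem (mem_nhdsWithin_of_mem_nhds hV) self_mem_nhdsWithin, ?_⟩
  -- Passing to the limit in the joint estimate controls `f` near `x`, so continuity of `f` need not
  -- be assumed.
  have hf : ∀ y, V y → y ∈ K → dist (f y) (f x) ≤ ε / 3 := fun y hy hyK =>
    le_of_tendsto ((tendsto_apply_of_prod_nhds (h y hyK)).dist tendsto_const_nhds)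
      (hS.mono fun p hp => (hSV hp hy).le)
  filter_upwards [hS] with p hp y hy
  have h1 := hf y hy.1 hy.2
  have h2 : dist (F p y) (f x) < ε / 3 := hSV hp hy.1
  have h3 := dist_triangle_right (f y) (F p y) (f x)
  linarith

theorem isHermitian_of_tendsto {α : Type*} {l : Filter α} [l.NeBot]
    {F : α → Matrix (Fin r) (Fin r) ℂ} {L : Matrix (Fin r) (Fin r) ℂ} (h : Tendsto F l (𝓝 L))
    (hF : ∀ᶠ p in l, (F p).IsHermitian) : L.IsHermitian :=
  tendsto_nhds_unique (h.star.congr' (hF.mono fun _ hp => hp.eq)) h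

end RatioAsymptotics
end

/-! ### Assembly of the three assertions -/

open RatioAsymptotics in
theorem theorem3p1 {r : ℕ}
    -- the recurrence coefficients `A_{n,N}` and `B_{n,N}`, for `n ≥ 0` and real `N > 0`
    (A B : ℕ → ℝ → Matrix (Fin r) (Fin r) ℂ)
    (hA : ∀ n : ℕ, 1 ≤ n → ∀ N : ℝ, 0 < N → (A n N).det ≠ 0)
    (hB : ∀ n : ℕ, ∀ N : ℝ, 0 < N → (B n N).IsHermitian)
    -- their local limits `A_s` and `B_s`
    (As Bs : ℝ → Matrix (Fin r) (Fin r) ℂ)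
    (hAlim : ∀ s : ℝ, 0 < s →
      Tendsto (fun p : ℕ × ℝ => A p.1 p.2) (localLim s) (𝓝 (As s)))
    (hBlim : ∀ s : ℝ, 0 < s →
      Tendsto (fun p : ℕ × ℝ => B p.1 p.2) (localLim s) (𝓝 (Bs s)))
    (hAs : ∀ s : ℝ, 0 < s → (As s).det ≠ 0)
    (hAcont : ContinuousOn As (Set.Ici 0))
    (hBcont : ContinuousOn Bs (Set.Ici 0))
    (s : ℝ) (hs : 0 < s)
    -- the zeros of `det P_{n,N}` lie in `[-M, M]` when `n, N` are large and `n / N` is near `s`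
    (M : ℝ) (hM : 0 < M)
    (hzeros : ∀ᶠ p : ℕ × ℝ in localLim s, ∀ x : ℂ,
      (orthPoly (fun n => A n p.2) (fun n => B n p.2) p.1 x).det = 0 → x ∈ realInterval M) :
    (exceptionalSet (As s) (Bs s)).Finite ∧
    (∃ R : ℂ → Matrix (Fin r) (Fin r) ℂ,
      (∀ x : ℂ, x ∉ realInterval M ∪ exceptionalSet (As s) (Bs s) →
        (∀ i j : Fin r, Tendsto
          (fun p : ℕ × ℝ =>
            (orthPoly (fun n => A n p.2) (fun n => B n p.2) p.1 x *
              (orthPoly (fun n => A n p.2) (fun n => B n p.2) (p.1 + 1) x)⁻¹) i j)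
          (localLim s) (𝓝 (R x i j))) ∧
        IsDiagonalizable (R x) ∧
        ∀ (z : Fin (2 * r) → ℂ) (v : Fin (2 * r) → Fin r → ℂ),
          IsEigenSystem (As s) (Bs s) x z v →
            LinearIndependent ℂ (fun k : Fin r => v (smallIdx k)) ∧
            ∀ k : Fin r, R x *ᵥ v (smallIdx k) = z (smallIdx k) • v (smallIdx k)) ∧
      (∀ K : Set ℂ, IsCompact K →
        K ⊆ (realInterval M ∪ exceptionalSet (As s) (Bs s))ᶜ →
        ∀ i j : Fin r, TendstoUniformlyOn
          (fun (p : ℕ × ℝ) (x : ℂ) =>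
            (orthPoly (fun n => A n p.2) (fun n => B n p.2) p.1 x *
              (orthPoly (fun n => A n p.2) (fun n => B n p.2) (p.1 + 1) x)⁻¹) i j)
          (fun x => R x i j) (localLim s) K)) ∧
    (∀ z : ℂ → Fin (2 * r) → ℂ, (∀ x : ℂ, IsRootLabelling (As s) (Bs s) x (z x)) →
      ∀ K : Set ℂ, IsCompact K → K ⊆ (realInterval M)ᶜ →
        TendstoUniformlyOn
          (fun (p : ℕ × ℝ) (x : ℂ) =>
            (orthPoly (fun n => A n p.2) (fun n => B n p.2) p.1 x).det /
              (orthPoly (fun n => A n p.2) (fun n => B n p.2) (p.1 + 1) x).det)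
          (fun x => ∏ k : Fin r, z x (smallIdx k)) (localLim s) K) := by
  have hne := localLim_neBot hs
  have hAs' := hAs s hs
  have hBs : (Bs s).IsHermitian := isHermitian_of_tendsto (hBlim s hs)
    (((localLim_snd s).eventually_gt_atTop 0).mono fun p hp => hB _ _ hp)
  obtain ⟨W, hW⟩ := exists_green_limit hs hA hB (hAlim s hs) (hBlim s hs) hzeros
  have hratio : ∀ x, x ∉ realInterval M → _ := fun x hx =>
    tendsto_ratio_joint hA (hAlim s hs) (hW x hx)
  have hquad : ∀ x, x ∉ realInterval M → _ := fun x hx =>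
    ratio_limit_quadratic hs hA (hAlim s hs) (hBlim s hs) hzeros hW hx
  have hpow : ∀ x, x ∉ realInterval M → _ := fun x hx =>
    ratio_limit_pow_tendsto_zero hs hA hB (hAlim s hs) hAs' hzeros hx (hW x hx)
  have hpow' : ∀ x, x ∉ realInterval M →
      Tendsto (fun m : ℕ => ((W x)ᴴ * As s) ^ m) atTop (𝓝 0) := fun x hx => by
    -- `W(x)^* A` is the ratio limit at `x̄`, which also avoids `[-M, M]`.
    rw [← green_limit_star hs hA hB hzeros hW hx]
    exact hpow _ fun h => hx (conj_mem_realInterval.1 h)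
  refine ⟨finite_exceptionalSet hAs' hBs, ⟨fun x => W x * As s, fun x hx => ?_,
    fun K hK hKsub i j => ?_⟩, fun z hz K hK hKsub => ?_⟩
  · rw [Set.mem_union, not_or] at hx
    obtain ⟨hxI, hxS⟩ := hx
    have heig : ∀ (z : Fin (2 * r) → ℂ) (v : Fin (2 * r) → Fin r → ℂ),
        IsEigenSystem (As s) (Bs s) x z v →
          LinearIndependent ℂ (fun k : Fin r => v (smallIdx k)) ∧
          ∀ k : Fin r, (W x * As s) *ᵥ v (smallIdx k) = z (smallIdx k) • v (smallIdx k) := by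
      intro z v hzv
      have h1 := mulVec_eq_smul_of_isEigenSystem hAs' (hquad x hxI) rfl (hpow x hxI)
        (hpow' x hxI) hzv
      exact ⟨linearIndependent_smallIdx hzv h1, h1⟩
    refine ⟨fun i j => ?_, ?_, heig⟩
    · exact ((tendsto_ratio hA (hAlim s hs) (hW x hxI)).apply_nhds i).apply_nhds j
    · obtain ⟨z, v, hzv⟩ := not_not.1 hxS
      exact isDiagonalizable_of_eigenvectors (heig z v hzv).1 (heig z v hzv).2
  · exact tendstoUniformlyOn_of_prod_nhds hK fun x hx =>
      ((hratio x fun h => hKsub hx (Or.inl h)).apply_nhds i).apply_nhds j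
  · refine tendstoUniformlyOn_of_prod_nhds hK fun x hx => ?_
    have hxI : x ∉ realInterval M := hKsub hx
    rw [← det_eq_prod_smallIdx hAs' (hquad x hxI) rfl (hpow x hxI) (hpow' x hxI) (hz x)]
    refine ((continuous_id.matrix_det.tendsto _).comp (hratio x hxI)).congr fun q => ?_
    rw [Function.comp_apply, id, Matrix.det_mul, Matrix.det_nonsing_inv, Ring.inverse_eq_inv',
      div_eq_mul_inv]
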